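/- Let $\langle\cdot,\cdot\rangle$ be the standard Hermitian inner product on $\mathbb C^2$ (complex linear in the first argument), $S^3\subset\mathbb C^2$ the unit sphere, and $L>0$. **Legendrian loops.** Let $\mathscr L_L$ be the set of smooth regular $L$-periodic curves $\gamma:\mathbb R\to S^3$ with $\langle\gamma_x,\gamma\rangle=0$. For $\gamma\in\mathscr L_L$ let $\beta=\langle\gamma_x,\gamma_x\rangle^{1/2}$, $\partial_s=\beta^{-1}\partial_x$, $ds=\beta\,dx$, and $\kappa=\beta^{-3}\operatorname{Im}\langle\gamma_{xx},\gamma_x\rangle$. The tangent vectors to $\mathscr L_L$ at $\gamma$ are the fields $V=p\gamma_x+q(i\gamma_x)+r(i\gamma)$ with smooth real $L$-periodic $p,q,r$ such that $r_x=2q\langle\gamma_x,\gamma_x\rangle$. Let $\overline{\mathscr L}_L$ be the quotient of $\mathscr L_L$ by the transformations $\gamma\mapsto e^{i\theta}\gamma\circ\varphi$, with $\theta\in\mathbb R$ constant and $\varphi$ a smooth map with $\varphi'>0$ and $\varphi(x+L)=\varphi(x)+L$; two tangent vectors at $\gamma$ represent the same tangent vector to $\overline{\mathscr L}_L$ if they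 differ by $c\,(i\gamma)+f\gamma_x$ with $c\in\mathbb R$ constant and $f$ smooth and $L$-periodic. Put $$\Omega_{[\gamma]}(V,W)=-\int_0^L\det\nolimits_{\mathbb R}(\gamma,\gamma_x,V,W)\,dx,$$ where $(z_1,z_2)\in\mathbb C^2$ is identified with $(\operatorname{Re}z_1,\operatorname{Im}z_1,\operatorname{Re}z_2,\operatorname{Im}z_2)\in\mathbb R^4$. A vector field on $\overline{\mathscr L}_L$ represented by $W$ is the Hamiltonian vector field of a smooth functional $H$ on $\overline{\mathscr L}_L$ (that is, a functional on $\mathscr L_L$ invariant under these transformations and smooth along smooth families of loops) if, for every $\gamma\in\mathscr L_L$ and every smooth variation $\gamma(\cdot,t)\in\mathscr L_L$ of $\gamma$ with variation field $V=\partial_t\gamma|_{t=0}$, $$\frac{d}{dt}\Big|_{t=0}H(\gamma(\cdot,t))=\Omega_{[\gamma]}(V,W).$$ **The mKdV hierarchy.** On differential polynomials in $u=u_0,u_1,u_2,\dots$ with real coefficients let $D=\sum_j u_{j+1}\,\partial/\partial u_j$ and $\mathtt E=\sum_j(-D)^j\,\partial/\partial u_j$. Let $\rho_j$ and $N_j$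 $(j\ge1)$ be differential polynomials such that, with $M_j=D\,\mathtt E\rho_j$, $$\rho_1=\tfrac12u^2,\qquad DN_j=uM_j,\qquad D\,\mathtt E\rho_{j+1}=D^3\,\mathtt E\rho_j+D(uN_j)\qquad(j\ge1),$$ and such that $\rho_j$, $\mathtt E\rho_j$ and $N_j$ have no constant term. Let $L_j=2\,\mathtt E\rho_j$. With $u_i$ replaced by $\partial_s^i\kappa$, and $\gamma_s=\beta^{-1}\gamma_x$, put $$\mathbf V_j=N_j\gamma_s+M_j(i\gamma_s)+L_j(i\gamma),\qquad j\ge1.$$ **Proposition.** Such sequences $(\rho_j)$, $(N_j)$ exist. For every such choice and every $j\ge1$, $\mathbf V_j$ represents a Hamiltonian vector field on $\overline{\mathscr L}_L$. Moreover, for every $j\ge1$, $\mathbf V_{j+1}-(-4)^j\mathbf V_1$ represents the Hamiltonian vector field of the functional $$\gamma\mapsto-4\int_0^L\sum_{k=1}^j(-4)^{j-k}\rho_k(\kappa,\partial_s\kappa,\dots)\,ds .$$ -/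

import Mathlib

open scoped ContDiff

noncomputable section

namespace LegendrianMKdV

/-! ### Differential polynomials and the mKdV hierarchy -/

/-- Differential polynomials in `u`; the variable `X j` is `u_j`, the `j`-th derivative of `u`. -/
abbrev DiffPoly : Type := MvPolynomial ℕ ℝ

/-- The total derivative `D P = ∑ u_{j+1} ∂P/∂u_j`. -/
def totalD : Derivation ℝ DiffPoly DiffPoly :=
  MvPolynomial.mkDerivation ℝ (fun j : ℕ => (MvPolynomial.X (j + 1) : DiffPoly))

/-- The Euler operator `E P = ∑ (-D)^j (∂P/∂u_j)`; only variables that occur in `P` contribute. -/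
def euler (P : DiffPoly) : DiffPoly :=
  ∑ j ∈ P.vars, (-1 : DiffPoly) ^ j * (fun Q : DiffPoly => totalD Q)^[j] (MvPolynomial.pderiv j P)

/-- `ρ j` (for `j ≥ 1`) are the densities of the mKdV hierarchy and `N j` is the differential
polynomial `D⁻¹ (u M_j)`, where `M_j = D E ρ_j`:
`ρ_1 = u² / 2` and `D E ρ_{j+1} = (D³ + D u D⁻¹ u D) E ρ_j`.
The constants of integration are zero, as usual for `D⁻¹` on differential polynomials: neither
`N j`, nor `ρ j`, nor `E ρ_j` has a constant term. The values at `j = 0` play no role. -/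
structure IsMKdVHierarchy (ρ N : ℕ → DiffPoly) : Prop where
  rho_one : ρ 1 = MvPolynomial.C (1 / 2 : ℝ) * MvPolynomial.X 0 ^ 2
  totalD_N : ∀ j, 1 ≤ j → totalD (N j) = MvPolynomial.X 0 * totalD (euler (ρ j))
  recursion : ∀ j, 1 ≤ j → totalD (euler (ρ (j + 1))) =
    totalD (totalD (totalD (euler (ρ j)))) + totalD (MvPolynomial.X 0 * N j)
  constantCoeff_N : ∀ j, 1 ≤ j → MvPolynomial.constantCoeff (N j) = 0
  constantCoeff_rho : ∀ j, 1 ≤ j → MvPolynomial.constantCoeff (ρ j) = 0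
  constantCoeff_euler : ∀ j, 1 ≤ j → MvPolynomial.constantCoeff (euler (ρ j)) = 0

/-! ### Legendrian loops in the 3-sphere -/

/-- `ℂ²` with its standard Hermitian norm. -/
abbrev C2 : Type := EuclideanSpace ℂ (Fin 2)

/-- The Hermitian inner product, complex linear in the first argument. -/
def herm (z w : C2) : ℂ := inner ℂ w z

/-- `γ` is a smooth regular parametrized Legendrian curve in the unit sphere of `ℂ²`, with
period `L`. -/
structure IsLegendrianLoop (L : ℝ) (γ : ℝ → C2) : Prop where
  smooth : ContDiff ℝ ∞ γ
  sphere : ∀ x, ‖γ x‖ = 1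
  periodic : Function.Periodic γ L
  regular : ∀ x, deriv γ x ≠ 0
  legendrian : ∀ x, herm (deriv γ x) (γ x) = 0

/-- The speed `⟨γ_x, γ_x⟩^{1/2}`. -/
def speed (γ : ℝ → C2) (x : ℝ) : ℝ := ‖deriv γ x‖

/-- The curvature `Im ⟨γ_xx, γ_x⟩ / ⟨γ_x, γ_x⟩^{3/2}`. -/
def curvature (γ : ℝ → C2) (x : ℝ) : ℝ :=
  (herm (deriv (deriv γ) x) (deriv γ x)).im / speed γ x ^ 3

/-- The derivative `∂/∂s = speed⁻¹ ∂/∂x` with respect to arclength along `γ`. -/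
def arcDeriv (γ : ℝ → C2) (g : ℝ → ℝ) (x : ℝ) : ℝ := (speed γ x)⁻¹ * deriv g x

/-- The function along `γ` obtained from a differential polynomial by replacing `u_j` with the
`j`-th arclength derivative of the curvature. -/
def evalCurv (P : DiffPoly) (γ : ℝ → C2) (x : ℝ) : ℝ :=
  MvPolynomial.eval (fun j : ℕ => (arcDeriv γ)^[j] (curvature γ) x) P

/-- The functional `γ ↦ ∫ f(k, k_1, …) ds`. -/
def curvFunctional (L : ℝ) (f : DiffPoly) (γ : ℝ → C2) : ℝ :=
  ∫ x in (0 : ℝ)..L, evalCurv f γ x * speed γ x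

/-! ### The quotient by rotations and reparametrizations, and the symplectic form -/

/-- Smooth orientation-preserving reparametrizations that fix the period `L`. -/
structure IsReparam (L : ℝ) (φ : ℝ → ℝ) : Prop where
  smooth : ContDiff ℝ ∞ φ
  deriv_pos : ∀ x, 0 < deriv φ x
  shift : ∀ x, φ (x + L) = φ x + L

/-- The action `(θ, φ) · V = e^{iθ} V ∘ φ` on curves, and (being linear) on vector fields along
curves. -/
def act (θ : ℝ) (φ : ℝ → ℝ) (V : ℝ → C2) (x : ℝ) : C2 :=
  Complex.exp (θ * Complex.I) • V (φ x)

/-- `V = p γ_x + q (iγ_x) + r (iγ)` with `L`-periodic `p, q, r` and `r_x = 2 q ⟨γ_x, γ_x⟩`: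
the vector fields along `γ` tangent to the space of Legendrian loops. -/
def IsTangent (L : ℝ) (γ V : ℝ → C2) : Prop :=
  ∃ p q r : ℝ → ℝ, ContDiff ℝ ∞ p ∧ ContDiff ℝ ∞ q ∧ ContDiff ℝ ∞ r ∧
    Function.Periodic p L ∧ Function.Periodic q L ∧ Function.Periodic r L ∧
    (∀ x, deriv r x = 2 * q x * speed γ x ^ 2) ∧
    ∀ x, V x = p x • deriv γ x + q x • (Complex.I • deriv γ x) + r x • (Complex.I • γ x)

/-- `V = c (iγ) + f γ_x` with `c` constant and `f` periodic: the vector fields along `γ` that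
represent zero on the quotient by rotations and reparametrizations. -/
def IsVertical (L : ℝ) (γ V : ℝ → C2) : Prop :=
  ∃ (c : ℝ) (f : ℝ → ℝ), ContDiff ℝ ∞ f ∧ Function.Periodic f L ∧
    ∀ x, V x = c • (Complex.I • γ x) + f x • deriv γ x

/-- `(Re z₁, Im z₁, Re z₂, Im z₂)`. -/
def realCoords (z : C2) : Fin 4 → ℝ := ![(z 0).re, (z 0).im, (z 1).re, (z 1).im]

/-- The real determinant of four vectors (as columns) under `ℂ² ≅ ℝ⁴`. -/
def detR (a b c d : C2) : ℝ :=
  (Matrix.of ![realCoords a, realCoords b, realCoords c, realCoords d]).transpose.det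

/-- The symplectic form on representatives, `Ω(V, W) = -∫ det(γ, γ_x, V, W) dx`. -/
def Omega (L : ℝ) (γ V W : ℝ → C2) : ℝ :=
  -∫ x in (0 : ℝ)..L, detR (γ x) (deriv γ x) (V x) (W x)

/-- `Γ x t`, `|t| < ε`, is a smooth one-parameter family of Legendrian loops of period `L`. -/
structure IsSmoothFamily (L ε : ℝ) (Γ : ℝ → ℝ → C2) : Prop where
  smooth : ContDiffOn ℝ ∞ (fun z : ℝ × ℝ => Γ z.1 z.2) (Set.univ ×ˢ Set.Ioo (-ε) ε)
  loop : ∀ t ∈ Set.Ioo (-ε) ε, IsLegendrianLoop L (fun x => Γ x t)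

/-- `H` is a smooth functional on the quotient: it is invariant under rotations and
reparametrizations, and smooth along every smooth family of loops. -/
structure IsSmoothInvariantFunctional (L : ℝ) (H : (ℝ → C2) → ℝ) : Prop where
  invariant : ∀ γ, IsLegendrianLoop L γ → ∀ (θ : ℝ) (φ : ℝ → ℝ), IsReparam L φ →
    H (act θ φ γ) = H γ
  smooth : ∀ (ε : ℝ) (Γ : ℝ → ℝ → C2), 0 < ε → IsSmoothFamily L ε Γ →
    ContDiffOn ℝ ∞ (fun t => H (fun x => Γ x t)) (Set.Ioo (-ε) ε)

/-- `W` represents a vector field on the quotient: it is tangent to the space of loops, and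
along equivalent loops its values agree modulo vertical fields. -/
structure RepresentsVectorField (L : ℝ) (W : (ℝ → C2) → ℝ → C2) : Prop where
  tangent : ∀ γ, IsLegendrianLoop L γ → IsTangent L γ (W γ)
  descends : ∀ γ, IsLegendrianLoop L γ → ∀ (θ : ℝ) (φ : ℝ → ℝ), IsReparam L φ →
    IsVertical L (act θ φ γ) (fun x => W (act θ φ γ) x - act θ φ (W γ) x)

/-- `W` represents the Hamiltonian vector field of `H` on the quotient:
`dH(V) = Ω(V, W)` for the variation field `V` of every smooth variation of every loop. -/
structure IsHamiltonianFieldOf (L : ℝ) (H : (ℝ → C2) → ℝ) (W : (ℝ → C2) → ℝ → C2) : Prop where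
  functional : IsSmoothInvariantFunctional L H
  field : RepresentsVectorField L W
  hamilton : ∀ (γ : ℝ → C2) (ε : ℝ) (Γ : ℝ → ℝ → C2), 0 < ε → IsSmoothFamily L ε Γ →
    (∀ x, Γ x 0 = γ x) →
    HasDerivAt (fun t => H (fun x => Γ x t)) (Omega L γ (fun x => deriv (Γ x) 0) (W γ)) 0

/-- The field `V_j = N_j γ_s + M_j (iγ_s) + L_j (iγ)` with `M_j = D E ρ_j`, `L_j = 2 E ρ_j`,
evaluated at the curvature of `γ`. -/
def mkdvField (ρ N : ℕ → DiffPoly) (j : ℕ) (γ : ℝ → C2) (x : ℝ) : C2 :=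
  evalCurv (N j) γ x • ((speed γ x)⁻¹ • deriv γ x)
    + evalCurv (totalD (euler (ρ j))) γ x • (Complex.I • ((speed γ x)⁻¹ • deriv γ x))
    + evalCurv (2 * euler (ρ j)) γ x • (Complex.I • γ x)

end LegendrianMKdV

end

noncomputable section

namespace LegendrianMKdV

section

open MvPolynomial

/-! ### The ring of differential polynomials -/

/-! Write `T = γ_s` and decompose a variation field as `V = aT + b(iT) + c(iγ)`; the linearized
Legendrian condition is `c_s = 2b`. Then `δ(ds) = (a_s - κb) ds` and `δκ = aκ_s + b_ss + (κ² + 4)b`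
(`IsSmoothFamily.hasDerivAt_speed`, `IsSmoothFamily.hasDerivAt_curvature`). These are the formulas
for a curve of curvature `κ` on a sphere of curvature 4, the base of the Hopf fibration.

Let `G` be the polynomial with `D G = u₁ E P` given by Noether's identity. Integration by parts
gives `δ∫P ds = ∫ b ∇P ds` with `∇P = D²EP + (u² + 4)EP - uG` (`normalGrad`). On the other side,
`Ω(V, nT + (Dℓ)iT + 2ℓ iγ) = ∫ -4bℓ ds` for every `n`. So this field is Hamiltonian for `∫P ds` as
soon as `∇P = -4ℓ` (`isHamiltonianFieldOf_localField`).

For the hierarchy, `G = u Eρ_j - N_j`, and the recursion turns `∇ρ_j` into `Eρ_{j+1} + 4Eρ_j`.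
Weights `(-4)^{j-k}` make the sum telescope to `Eρ_{j+1} - (-4)^j Eρ_1`. A constant density `c` has
`∇c = -cu`, a multiple of `Eρ_1 = u`, so adding a multiple of the length makes each `V_j` itself
Hamiltonian.

Existence is the algebraic half. The recursion is run on pairs `(Eρ_n, N_n)` from the seed `(0, 1)`.
The generating series satisfy `zF'' = F - zuN` and `N' = uF'`, a linear system with first integral
`N² + F'² - F²/z = 1`. Its coefficients express each new `N_n` through earlier terms, so `u D Eρ_n`
is exact (`totalD_flux`). That the `Eρ_n` really are Euler gradients follows from the trace identity
`δN ≡ (2zF_z - F) δu` modulo total derivatives. It yields `E N_n = (2n - 1) Eρ_n` (`euler_flux`), so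
`ρ_n = N_n / (2n - 1)` works. -/

@[simp] theorem totalD_X (j : ℕ) : totalD (X j) = X (j + 1) := by
  simp [totalD]

@[simp] theorem totalD_C (a : ℝ) : totalD (C a) = 0 := by
  simp [totalD]

theorem totalD_C_mul (a : ℝ) (P : DiffPoly) : totalD (C a * P) = C a * totalD P := by
  simp [Derivation.leibniz]

theorem derivation_sum_apply (s : Finset ℕ) (d : ℕ → Derivation ℝ DiffPoly DiffPoly)
    (P : DiffPoly) : (∑ j ∈ s, d j) P = ∑ j ∈ s, d j P := by
  classical
  induction s using Finset.induction_on with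
  | empty => simp
  | insert a s ha ih => rw [Finset.sum_insert ha, Finset.sum_insert ha, Derivation.add_apply, ih]

/-- Chain rule for derivations of the polynomial ring. -/
theorem derivation_eq_sum_pderiv (d : Derivation ℝ DiffPoly DiffPoly) {P : DiffPoly}
    {s : Finset ℕ} (hs : P.vars ⊆ s) : d P = ∑ j ∈ s, pderiv j P * d (X j) := by
  have h := derivation_eq_of_forall_mem_vars (D₁ := d)
    (D₂ := ∑ j ∈ s, d (X j) • (pderiv j : Derivation ℝ DiffPoly DiffPoly)) (f := P) ?_
  · rw [h]
    simp [derivation_sum_apply, mul_comm]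
  · intro i hi
    have his := hs hi
    simp only [derivation_sum_apply, Derivation.smul_apply, pderiv_X, smul_eq_mul]
    rw [Finset.sum_eq_single_of_mem i his]
    · simp
    · intro j _ hj
      simp [hj.symm]

/-- Characteristic zero: a monomial containing `u_n` with exponent `k ≥ 1` contributes its
coefficient times `k`, and distinct monomials stay distinct after lowering that exponent. -/
theorem pderiv_ne_zero_of_mem_vars {P : DiffPoly} {n : ℕ} (h : n ∈ P.vars) :
    pderiv n P ≠ 0 := by
  obtain ⟨m, hm, hn⟩ := (mem_vars_iff_mem_support n).1 h
  intro h0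
  have h1 := coeff_pderiv (i := n) P (m - Finsupp.single n 1)
  have h2 : m - Finsupp.single n 1 + Finsupp.single n 1 = m := by
    apply tsub_add_cancel_of_le
    rw [Finsupp.single_le_iff]
    have := Finsupp.mem_support_iff.1 hn
    omega
  rw [h0, h2, coeff_zero] at h1
  have h3 : coeff m P ≠ 0 := mem_support_iff.1 hm
  have h4 : ((m - Finsupp.single n 1 : ℕ →₀ ℕ) n : ℝ) + 1 ≠ 0 := by positivity
  exact (mul_ne_zero h3 h4) h1.symm

/-- The commutator of two derivations is a derivation, so it is enough to compare on the generators.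
At the top variable `u_n` of `P` the last term vanishes: `D P` is then linear in `u_{n+1}` with
leading coefficient `∂P/∂u_n ≠ 0`. -/
theorem pderiv_totalD (n : ℕ) (P : DiffPoly) :
    pderiv (n + 1) (totalD P) = pderiv n P + totalD (pderiv (n + 1) P) := by
  have h : ⁅(pderiv (n + 1) : Derivation ℝ DiffPoly DiffPoly), totalD⁆ = pderiv n := by
    apply derivation_ext
    intro i
    rw [Derivation.commutator_apply]
    simp only [totalD_X, pderiv_X, Pi.single_apply]
    by_cases h1 : i = n <;> by_cases h2 : i = n + 1 <;> simp_all
  have h' := congrArg (fun d : Derivation ℝ DiffPoly DiffPoly => d P) h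
  simp only [Derivation.commutator_apply] at h'
  rw [← h']
  ring

theorem vars_subset_range (P : DiffPoly) : ∃ n, ∀ m, n ≤ m → P.vars ⊆ Finset.range m := by
  refine ⟨P.vars.sup id + 1, fun m hm i hi => ?_⟩
  have : i ≤ P.vars.sup id := Finset.le_sup (f := id) hi
  simp; omega

theorem exists_top_var {P : DiffPoly} (h : P.vars.Nonempty) :
    ∃ n ∈ P.vars, ∀ m, n < m → m ∉ P.vars :=
  ⟨P.vars.max' h, P.vars.max'_mem h, fun m hm hmem => absurd (P.vars.le_max' m hmem) (by omega)⟩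

/-- The kernel of the total derivative consists of the constants. -/
theorem eq_C_of_totalD_eq_zero {P : DiffPoly} (h : totalD P = 0) :
    P = C (constantCoeff P) := by
  rcases P.vars.eq_empty_or_nonempty with h0 | h0
  · exact vars_eq_empty_iff_eq_C.1 h0
  · obtain ⟨n, hn, hmax⟩ := exists_top_var h0
    have h1 := pderiv_totalD n P
    rw [h, pderiv_eq_zero_of_notMem_vars (hmax (n + 1) (by omega))] at h1
    simp only [map_zero, add_zero] at h1
    exact absurd h1.symm (pderiv_ne_zero_of_mem_vars hn)

theorem eq_of_totalD_eq {P Q : DiffPoly} (h : totalD P = totalD Q)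
    (hc : constantCoeff P = constantCoeff Q) : P = Q := by
  have h1 : P - Q = C (constantCoeff (P - Q)) := eq_C_of_totalD_eq_zero (by simp [h])
  rw [map_sub, hc, sub_self, C_0] at h1
  exact sub_eq_zero.1 h1

theorem constantCoeff_totalD (P : DiffPoly) : constantCoeff (totalD P) = 0 := by
  rw [derivation_eq_sum_pderiv totalD (Finset.Subset.refl _)]
  simp

/-- A nonzero square is not a total derivative. -/
theorem eq_zero_of_sq_eq_totalD {g h : DiffPoly} (hgh : totalD h = g ^ 2) : g = 0 := by
  by_contra hg
  rcases h.vars.eq_empty_or_nonempty with h0 | h0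
  · rw [vars_eq_empty_iff_eq_C.1 h0, totalD_C] at hgh
    exact hg (pow_eq_zero_iff (two_ne_zero) |>.1 hgh.symm)
  · obtain ⟨n, hn, hmax⟩ := exists_top_var h0
    -- With `u_n` the top variable of `h`, `D h` has degree at most 1 in `u_{n+1}`, whereas `g²` has
    -- even degree. Hence `g` does not involve `u_{n+1}`, which contradicts the nonzero coefficient
    -- `∂h/∂u_n`.
    have hdeg : degreeOf (n + 1) (totalD h) ≤ 1 := by
      rw [derivation_eq_sum_pderiv totalD (Finset.Subset.refl _)]
      refine (degreeOf_sum_le _ _ _).trans (Finset.sup_le fun j _ => ?_)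
      refine (degreeOf_mul_le _ _ _).trans ?_
      have h1 : degreeOf (n + 1) (pderiv j h) = 0 := by
        by_contra h2
        have h3 : n + 1 ∈ (pderiv j h).vars := mem_vars_iff_degreeOf_ne_zero.2 h2
        have h5 := pderiv_ne_zero_of_mem_vars h3
        have h6 : pderiv (n + 1) (pderiv j h) = pderiv j (pderiv (n + 1) h) := by
          have : ⁅(pderiv (n + 1) : Derivation ℝ DiffPoly DiffPoly),
              (pderiv j : Derivation ℝ DiffPoly DiffPoly)⁆ = 0 := by
            apply derivation_ext
            intro i
            rw [Derivation.commutator_apply]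
            simp only [pderiv_X, Pi.single_apply]
            split_ifs <;> simp
          have h' := congrArg (fun d : Derivation ℝ DiffPoly DiffPoly => d h) this
          simp only [Derivation.commutator_apply] at h'
          exact sub_eq_zero.1 h'
        rw [h6, pderiv_eq_zero_of_notMem_vars (hmax (n + 1) (by omega))] at h5
        simp at h5
      rw [h1, totalD_X, degreeOf_X]
      split_ifs <;> simp
    rw [hgh, degreeOf_pow_eq _ _ _ hg] at hdeg
    have hd0 : degreeOf (n + 1) g = 0 := by omega
    have h1 := pderiv_totalD n h
    have hp : pderiv (n + 1) g = 0 := by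
      by_contra h2
      have h3 : n + 1 ∈ g.vars := by
        by_contra h4
        exact h2 (pderiv_eq_zero_of_notMem_vars h4)
      exact mem_vars_iff_degreeOf_ne_zero.1 h3 hd0
    rw [hgh, pderiv_eq_zero_of_notMem_vars (hmax (n + 1) (by omega)), pderiv_pow, hp] at h1
    simp only [map_zero, add_zero, mul_zero] at h1
    exact pderiv_ne_zero_of_mem_vars hn h1.symm

/-! ### The Euler operator -/

/-- The operator `-D`. -/
def negD (Q : DiffPoly) : DiffPoly := -totalD Q

theorem iterate_negD (j : ℕ) (Q : DiffPoly) :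
    negD^[j] Q = (-1 : DiffPoly) ^ j * (fun Q : DiffPoly => totalD Q)^[j] Q := by
  induction j with
  | zero => simp
  | succ j ih =>
    rw [Function.iterate_succ_apply', ih, Function.iterate_succ_apply', negD, Derivation.leibniz]
    have : totalD ((-1 : DiffPoly) ^ j) = 0 := by
      have h : ((-1 : DiffPoly) ^ j) = C ((-1 : ℝ) ^ j) := by simp
      rw [h, totalD_C]
    rw [this]
    simp only [smul_eq_mul]
    ring

theorem iterate_negD_zero (j : ℕ) : negD^[j] 0 = 0 := by
  rw [iterate_negD]
  have : (fun Q : DiffPoly => totalD Q)^[j] 0 = 0 :=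
    Function.iterate_fixed (by simp) j
  simp [this]

theorem iterate_negD_add (j : ℕ) (P Q : DiffPoly) :
    negD^[j] (P + Q) = negD^[j] P + negD^[j] Q := by
  induction j generalizing P Q with
  | zero => rfl
  | succ j ih =>
    simp only [Function.iterate_succ_apply]
    rw [← ih]
    simp only [negD, map_add]
    ring_nf

theorem iterate_negD_C_mul (j : ℕ) (a : ℝ) (Q : DiffPoly) :
    negD^[j] (C a * Q) = C a * negD^[j] Q := by
  induction j generalizing Q with
  | zero => rfl
  | succ j ih =>
    simp only [Function.iterate_succ_apply]
    rw [← ih]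
    simp only [negD, totalD_C_mul, mul_neg]

/-- Variables absent from `P` contribute zero. This freedom in the index set is needed for
linearity, because `vars` is not additive when terms cancel. -/
theorem euler_eq_sum {P : DiffPoly} {s : Finset ℕ} (hs : P.vars ⊆ s) :
    euler P = ∑ j ∈ s, negD^[j] (pderiv j P) := by
  unfold euler
  simp_rw [← iterate_negD]
  refine Finset.sum_subset hs fun j _ hj => ?_
  rw [pderiv_eq_zero_of_notMem_vars hj, iterate_negD_zero]

theorem euler_add (P Q : DiffPoly) : euler (P + Q) = euler P + euler Q := by
  obtain ⟨a, ha⟩ := vars_subset_range P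
  obtain ⟨b, hb⟩ := vars_subset_range Q
  obtain ⟨c, hc⟩ := vars_subset_range (P + Q)
  set n := max a (max b c)
  rw [euler_eq_sum (ha n (by omega)), euler_eq_sum (hb n (by omega)),
    euler_eq_sum (hc n (by omega)), ← Finset.sum_add_distrib]
  simp only [map_add, iterate_negD_add]

theorem euler_C_mul (a : ℝ) (P : DiffPoly) : euler (C a * P) = C a * euler P := by
  obtain ⟨b, hb⟩ := vars_subset_range P
  obtain ⟨c, hc⟩ := vars_subset_range (C a * P)
  set n := max b c
  rw [euler_eq_sum (hb n (by omega)), euler_eq_sum (hc n (by omega)), Finset.mul_sum]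
  simp only [pderiv_C_mul, iterate_negD_C_mul]

theorem euler_C (a : ℝ) : euler (C a) = 0 := by
  simp [euler]

/-! ### Noether's identity `u₁ E P = D G` -/

/-- The boundary term in `Q D^j v = (-D)^j Q v + D(…)` that multiplies the stretching of the
arclength element. -/
def noether : ℕ → DiffPoly → DiffPoly
  | 0, _ => 0
  | j + 1, Q => Q * X (j + 1) + noether j (negD Q)

theorem totalD_noether (j : ℕ) (Q : DiffPoly) :
    totalD (noether j Q) = Q * X (j + 1) - negD^[j] Q * X 1 := by
  induction j generalizing Q with
  | zero => simp [noether]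
  | succ j ih =>
    simp only [noether, map_add, ih, Derivation.leibniz, totalD_X, smul_eq_mul,
      Function.iterate_succ_apply]
    simp only [negD]
    ring

theorem constantCoeff_noether (j : ℕ) (Q : DiffPoly) : constantCoeff (noether j Q) = 0 := by
  induction j generalizing Q with
  | zero => simp [noether]
  | succ j ih => simp [noether, ih]

/-- The first integral `G` with `D G = u₁ E P`. -/
def energy (P : DiffPoly) : DiffPoly := P - ∑ j ∈ P.vars, noether j (pderiv j P)

/-- Expand `D P = ∑ (∂P/∂u_j) u_{j+1}` and move `j` derivatives off `u_{j+1} = D^j u₁`; the boundary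
terms are the `noether` polynomials. In the variation of `∫P ds`, this makes the tangential
component drop out. -/
theorem totalD_energy (P : DiffPoly) : totalD (energy P) = X 1 * euler P := by
  rw [energy, map_sub, map_sum, euler_eq_sum (Finset.Subset.refl _),
    derivation_eq_sum_pderiv totalD (Finset.Subset.refl P.vars), ← Finset.sum_sub_distrib,
    Finset.mul_sum]
  refine Finset.sum_congr rfl fun j _ => ?_
  rw [totalD_noether, totalD_X]
  ring

theorem constantCoeff_energy (P : DiffPoly) :
    constantCoeff (energy P) = constantCoeff P := by
  simp [energy, constantCoeff_noether]

/-! ### Evolutionary derivations -/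

/-- The evolutionary derivation with characteristic `g`: `u_j ↦ D^j g`. -/
def evolve (g : DiffPoly) : Derivation ℝ DiffPoly DiffPoly :=
  mkDerivation ℝ fun j : ℕ => (fun Q : DiffPoly => totalD Q)^[j] g

theorem evolve_X (g : DiffPoly) (j : ℕ) :
    evolve g (X j) = (fun Q : DiffPoly => totalD Q)^[j] g := by
  simp [evolve]

theorem evolve_totalD (g P : DiffPoly) : evolve g (totalD P) = totalD (evolve g P) := by
  have h : ⁅evolve g, totalD⁆ = 0 := by
    apply derivation_ext
    intro i
    rw [Derivation.commutator_apply]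
    simp only [totalD_X, evolve_X, Function.iterate_succ_apply']
    simp
  have h' := congrArg (fun d : Derivation ℝ DiffPoly DiffPoly => d P) h
  simp only [Derivation.commutator_apply] at h'
  exact sub_eq_zero.1 h'

/-- Integration by parts `j` times, modulo exact terms. -/
theorem exists_mul_iterate_totalD_eq (g Q : DiffPoly) (j : ℕ) :
    ∃ R, Q * (fun P : DiffPoly => totalD P)^[j] g = negD^[j] Q * g + totalD R := by
  induction j generalizing Q with
  | zero => exact ⟨0, by simp⟩
  | succ j ih =>
    obtain ⟨R, hR⟩ := ih (negD Q)
    refine ⟨R + Q * (fun P : DiffPoly => totalD P)^[j] g, ?_⟩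
    rw [Function.iterate_succ_apply', Function.iterate_succ_apply, map_add, Derivation.leibniz,
      ← add_assoc, ← hR]
    simp only [negD, smul_eq_mul]
    ring

/-- First variation formula: `δP = (E P) g` modulo total derivatives. -/
theorem exists_evolve_eq (g P : DiffPoly) : ∃ R, evolve g P = euler P * g + totalD R := by
  choose R hR using fun j => exists_mul_iterate_totalD_eq g (pderiv j P) j
  refine ⟨∑ j ∈ P.vars, R j, ?_⟩
  rw [derivation_eq_sum_pderiv (evolve g) (Finset.Subset.refl P.vars),
    euler_eq_sum (Finset.Subset.refl _), Finset.sum_mul, map_sum, ← Finset.sum_add_distrib]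
  exact Finset.sum_congr rfl fun j _ => by rw [evolve_X, hR]

end

section

open MvPolynomial

/-! ### Existence of the hierarchy -/

theorem C_two : (C (2 : ℝ) : DiffPoly) = 2 := map_ofNat _ 2

open scoped Classical in
/-- The antiderivative without constant term, if there is one. -/
def invD (Q : DiffPoly) : DiffPoly :=
  if h : ∃ P, totalD P = Q ∧ constantCoeff P = 0 then h.choose else 0

/-- Subtracting the constant term from any antiderivative gives an admissible one, so the default
value `0` is avoided. For the Lenard sequence the hypothesis is what `totalD_flux` establishes. -/
theorem totalD_invD {Q : DiffPoly} (h : ∃ P, totalD P = Q) : totalD (invD Q) = Q := by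
  have h' : ∃ P, totalD P = Q ∧ constantCoeff P = 0 := by
    obtain ⟨P, hP⟩ := h
    exact ⟨P - C (constantCoeff P), by simp [hP], by simp⟩
  rw [invD, dif_pos h']
  exact h'.choose_spec.1

theorem constantCoeff_invD (Q : DiffPoly) : constantCoeff (invD Q) = 0 := by
  unfold invD
  split_ifs with h
  · exact h.choose_spec.2
  · simp

/-- The pairs `(E ρ_n, N_n)`, started from `(0, 1)`. -/
def lenard : ℕ → DiffPoly × DiffPoly
  | 0 => (0, 1)
  | n + 1 =>
    let f := totalD (totalD (lenard n).1) + X 0 * (lenard n).2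
    (f, invD (X 0 * totalD f))

/-- The gradients `E ρ_n` of the hierarchy. -/
def grad (n : ℕ) : DiffPoly := (lenard n).1

/-- The antiderivatives `N_n` of `u D E ρ_n`. -/
def flux (n : ℕ) : DiffPoly := (lenard n).2

theorem grad_zero : grad 0 = 0 := rfl
theorem flux_zero : flux 0 = 1 := rfl

theorem grad_succ (n : ℕ) : grad (n + 1) = totalD (totalD (grad n)) + X 0 * flux n := rfl

theorem flux_succ (n : ℕ) : flux (n + 1) = invD (X 0 * totalD (grad (n + 1))) := rfl

theorem constantCoeff_flux_succ (n : ℕ) : constantCoeff (flux (n + 1)) = 0 :=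
  constantCoeff_invD _

theorem constantCoeff_grad (n : ℕ) : constantCoeff (grad n) = 0 := by
  cases n with
  | zero => simp [grad_zero]
  | succ n => simp [grad_succ, constantCoeff_totalD]

theorem totalD_sum_antidiagonal_mul_self (a : ℕ → DiffPoly) (n : ℕ) :
    totalD (∑ p ∈ Finset.HasAntidiagonal.antidiagonal n, a p.1 * a p.2) =
      2 * ∑ p ∈ Finset.HasAntidiagonal.antidiagonal n, a p.1 * totalD (a p.2) := by
  have hs : ∑ p ∈ Finset.HasAntidiagonal.antidiagonal n, a p.2 * totalD (a p.1) =
      ∑ p ∈ Finset.HasAntidiagonal.antidiagonal n, a p.1 * totalD (a p.2) :=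
    Finset.Nat.sum_antidiagonal_swap (f := fun p : ℕ × ℕ => a p.1 * totalD (a p.2))
  rw [map_sum]
  simp only [Derivation.leibniz, smul_eq_mul, Finset.sum_add_distrib]
  rw [hs]
  ring

/-- `u D E ρ_n` is a total derivative: the conservation law `N² + F'² - F² / z = 1` determines
`N_n` from the earlier terms. -/
theorem totalD_flux (n : ℕ) : totalD (flux n) = X 0 * totalD (grad n) := by
  induction n using Nat.strong_induction_on with
  | _ n ih =>
    cases n with
    | zero => simp [grad_zero, flux_zero]
    | succ n =>
      rw [flux_succ]
      apply totalD_invD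
      -- Truncating removes the unknown `N_{n+1}`. In the conservation law it occurs only as `2 N_0
      -- N_{n+1} = 2 N_{n+1}` in degree `n + 1`, so it should equal `-1/2` times the remaining
      -- terms. This is the witness.
      set M : ℕ → DiffPoly := fun i => if i ≤ n then flux i else 0 with hM
      refine ⟨-C (1 / 2) * (∑ p ∈ Finset.HasAntidiagonal.antidiagonal (n + 1), M p.1 * M p.2
        + ∑ p ∈ Finset.HasAntidiagonal.antidiagonal (n + 1), totalD (grad p.1) * totalD (grad p.2)
        - ∑ p ∈ Finset.HasAntidiagonal.antidiagonal (n + 2), grad p.1 * grad p.2), ?_⟩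
      rw [← C_neg, totalD_C_mul, map_sub, map_add, totalD_sum_antidiagonal_mul_self,
        totalD_sum_antidiagonal_mul_self (fun i => totalD (grad i)),
        totalD_sum_antidiagonal_mul_self]
      have h1 : ∑ p ∈ Finset.HasAntidiagonal.antidiagonal (n + 2), grad p.1 * totalD (grad p.2) =
          ∑ p ∈ Finset.HasAntidiagonal.antidiagonal (n + 1), grad (p.1 + 1) * totalD (grad p.2) := by
        rw [Finset.Nat.sum_antidiagonal_succ]
        simp [grad_zero]
      have h2 : ∑ p ∈ Finset.HasAntidiagonal.antidiagonal (n + 1), totalD (grad p.1) * totalD (totalD (grad p.2))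
          = ∑ p ∈ Finset.HasAntidiagonal.antidiagonal (n + 1), totalD (grad p.2) * totalD (totalD (grad p.1)) :=
        (Finset.Nat.sum_antidiagonal_swap
          (f := fun p : ℕ × ℕ => totalD (grad p.2) * totalD (totalD (grad p.1))))
      have h3 : ∑ p ∈ Finset.HasAntidiagonal.antidiagonal (n + 1), M p.1 * totalD (M p.2)
          + ∑ p ∈ Finset.HasAntidiagonal.antidiagonal (n + 1), totalD (grad p.1) * totalD (totalD (grad p.2))
          - ∑ p ∈ Finset.HasAntidiagonal.antidiagonal (n + 2), grad p.1 * totalD (grad p.2)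
          = -(X 0 * totalD (grad (n + 1))) := by
        -- The recursion cancels every summand except `(0, n + 1)`. There the truncation leaves only
        -- `-(grad 1) D(grad (n + 1))`, with `grad 1 = u`.
        rw [h1, h2, ← Finset.sum_add_distrib, ← Finset.sum_sub_distrib,
          Finset.sum_eq_single_of_mem (0, n + 1) (by simp)]
        · simp [hM, grad_succ 0, grad_zero, flux_zero]
        · rintro ⟨i, k⟩ hik hne
          rw [Finset.HasAntidiagonal.mem_antidiagonal] at hik
          simp only at hik ⊢
          have hi0 : i ≠ 0 := by rintro rfl; exact hne (by simp at hik; simp [hik])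
          have hk : k ≤ n := by omega
          rw [grad_succ]
          by_cases hi : i ≤ n
          · simp only [hM, if_pos hi, if_pos hk]
            rw [ih k (by omega)]
            ring
          · have : k = 0 := by omega
            subst this
            simp only [hM, if_neg hi, grad_zero, map_zero]
            ring
      have h4 : C (-(1 / 2) : ℝ) * (2 : DiffPoly) = -1 := by
        rw [← C_two, ← C_mul]
        norm_num
      linear_combination (C (-(1 / 2) : ℝ) * (2 : DiffPoly)) * h3
        - (X 0 * totalD (grad (n + 1))) * h4

/-! ### Formal power series of differential polynomials -/

theorem two_ne_zero_powerSeries : (2 : PowerSeries DiffPoly) ≠ 0 := by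
  intro h
  have h1 := congrArg (PowerSeries.coeff 0) h
  rw [show (2 : PowerSeries DiffPoly) = PowerSeries.C 2 by rw [map_ofNat], ← C_two] at h1
  simp at h1

/-- A derivation acting on the coefficients of power series. -/
def coeffwise (d : Derivation ℝ DiffPoly DiffPoly) :
    Derivation ℝ (PowerSeries DiffPoly) (PowerSeries DiffPoly) :=
  Derivation.mk'
    { toFun := fun f => PowerSeries.mk fun n => d (PowerSeries.coeff n f)
      map_add' := fun f g => by ext1 n; simp
      map_smul' := fun r f => by ext1 n; simp }
    fun f g => by
      ext1 n
      have h := Finset.Nat.sum_antidiagonal_swap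
        (f := fun p : ℕ × ℕ => PowerSeries.coeff p.1 g * d (PowerSeries.coeff p.2 f)) (n := n)
      simp only [Prod.fst_swap, Prod.snd_swap] at h
      simp [PowerSeries.coeff_mul, Finset.sum_add_distrib, h]

@[simp] theorem coeff_coeffwise (d : Derivation ℝ DiffPoly DiffPoly) (f : PowerSeries DiffPoly)
    (n : ℕ) : PowerSeries.coeff n (coeffwise d f) = d (PowerSeries.coeff n f) := by
  simp [coeffwise]

@[simp] theorem coeffwise_X (d : Derivation ℝ DiffPoly DiffPoly) :
    coeffwise d PowerSeries.X = 0 := by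
  ext1 n
  simp only [coeff_coeffwise, PowerSeries.coeff_X]
  split_ifs <;> simp

@[simp] theorem coeffwise_C (d : Derivation ℝ DiffPoly DiffPoly) (P : DiffPoly) :
    coeffwise d (PowerSeries.C P) = PowerSeries.C (d P) := by
  ext1 n
  simp only [coeff_coeffwise, PowerSeries.coeff_C]
  split_ifs <;> simp

/-- The operator `z d/dz` on power series. -/
def zdz (f : PowerSeries DiffPoly) : PowerSeries DiffPoly :=
  PowerSeries.X * PowerSeries.derivative DiffPoly f

theorem coeff_zdz (f : PowerSeries DiffPoly) (n : ℕ) :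
    PowerSeries.coeff n (zdz f) = n * PowerSeries.coeff n f := by
  cases n with
  | zero => simp [zdz]
  | succ n => simp [zdz, PowerSeries.coeff_succ_X_mul, PowerSeries.coeff_derivative, mul_comm]

theorem zdz_mul (f g : PowerSeries DiffPoly) : zdz (f * g) = f * zdz g + g * zdz f := by
  simp only [zdz, Derivation.leibniz, smul_eq_mul]
  ring

theorem zdz_add (f g : PowerSeries DiffPoly) : zdz (f + g) = zdz f + zdz g := by
  simp only [zdz, map_add]
  ring

theorem zdz_sub (f g : PowerSeries DiffPoly) : zdz (f - g) = zdz f - zdz g := by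
  simp only [zdz, map_sub]
  ring

theorem zdz_X : zdz PowerSeries.X = PowerSeries.X := by
  simp [zdz]

theorem zdz_C (P : DiffPoly) : zdz (PowerSeries.C P) = 0 := by
  simp [zdz]

theorem coeffwise_zdz (d : Derivation ℝ DiffPoly DiffPoly) (f : PowerSeries DiffPoly) :
    coeffwise d (zdz f) = zdz (coeffwise d f) := by
  ext1 n
  simp [coeff_zdz]

/-- The generating series of `grad`. -/
def gradSeries : PowerSeries DiffPoly := PowerSeries.mk grad

/-- The generating series of `flux`. -/
def fluxSeries : PowerSeries DiffPoly := PowerSeries.mk flux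

local notation "𝔻" => coeffwise totalD
local notation "𝔽" => gradSeries
local notation "𝔑" => fluxSeries
local notation "𝕫" => (PowerSeries.X : PowerSeries DiffPoly)
local notation "𝕌" => (PowerSeries.C (X 0) : PowerSeries DiffPoly)

theorem X_mul_coeffwise_gradSeries : 𝕫 * 𝔻 (𝔻 𝔽) = 𝔽 - 𝕫 * (𝕌 * 𝔑) := by
  ext1 n
  cases n with
  | zero => simp [gradSeries, grad_zero]
  | succ n => simp [gradSeries, fluxSeries, PowerSeries.coeff_succ_X_mul, grad_succ]

theorem coeffwise_fluxSeries : 𝔻 𝔑 = 𝕌 * 𝔻 𝔽 := by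
  ext1 n
  simp [gradSeries, fluxSeries, totalD_flux]

/-- The conservation law `N² + F'² - F² / z = 1`, multiplied by `z`. -/
theorem conservation_law : 𝕫 * 𝔑 ^ 2 + 𝕫 * (𝔻 𝔽) ^ 2 - 𝔽 ^ 2 = 𝕫 := by
  set K := 𝕫 * 𝔑 ^ 2 + 𝕫 * (𝔻 𝔽) ^ 2 - 𝔽 ^ 2 with hK
  have hD : 𝔻 K = 0 := by
    simp only [hK, pow_two, map_sub, map_add, Derivation.leibniz, coeffwise_X, smul_eq_mul,
      coeffwise_fluxSeries]
    linear_combination (2 * 𝔻 𝔽) * X_mul_coeffwise_gradSeries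
  -- Since `D` kills only constants, `K` is determined by its constant terms: `F` and `F'` have
  -- none, and `N` contributes only its seed `1`.
  have hF : PowerSeries.map (constantCoeff : DiffPoly →+* ℝ) 𝔽 = 0 := by
    ext1 n
    simp [gradSeries, constantCoeff_grad]
  have hP : PowerSeries.map (constantCoeff : DiffPoly →+* ℝ) (𝔻 𝔽) = 0 := by
    ext1 n
    simp [constantCoeff_totalD]
  have hN : PowerSeries.map (constantCoeff : DiffPoly →+* ℝ) 𝔑 = 1 := by
    ext1 n
    cases n with
    | zero => simp [fluxSeries, flux_zero]
    | succ n => simp [fluxSeries, constantCoeff_flux_succ, PowerSeries.coeff_one]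
  have hmap : PowerSeries.map (constantCoeff : DiffPoly →+* ℝ) K = PowerSeries.X := by
    simp [hK, hF, hP, hN]
  ext1 n
  have h1 : totalD (PowerSeries.coeff n K) = 0 := by
    have := congrArg (PowerSeries.coeff n) hD
    simpa using this
  have h2 := congrArg (PowerSeries.coeff n) hmap
  rw [PowerSeries.coeff_map] at h2
  rw [eq_C_of_totalD_eq_zero h1, h2, PowerSeries.coeff_X, PowerSeries.coeff_X]
  split_ifs <;> simp

/-- Trace identity: the variation of `N` is `(2 z F_z - F) g` modulo total derivatives. -/
theorem exists_evolve_fluxSeries (g : DiffPoly) :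
    ∃ Q, coeffwise (evolve g) 𝔑 = PowerSeries.C g * (2 * zdz 𝔽 - 𝔽) - 𝔻 Q := by
  set δ := coeffwise (evolve g) with hδ
  have comm : ∀ f, 𝔻 (δ f) = δ (𝔻 f) := fun f => by
    ext1 n
    simp [hδ, evolve_totalD]
  have hδU : δ 𝕌 = PowerSeries.C g := by simp [hδ, evolve_X]
  have hδz : δ 𝕫 = 0 := by simp [hδ]
  set P := 𝔻 𝔽 with hP
  have e1 := X_mul_coeffwise_gradSeries
  have e2 := coeffwise_fluxSeries
  have e3 := conservation_law
  rw [← hP] at e1 e2 e3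
  have d1 : 𝕫 * 𝔻 (δ P) = δ 𝔽 - 𝕫 * (𝕌 * δ 𝔑 + 𝔑 * PowerSeries.C g) := by
    have := congrArg δ e1
    simp only [map_sub, Derivation.leibniz, smul_eq_mul, hδz, hδU] at this
    rw [comm]
    linear_combination this
  have d2 : 𝔻 (δ 𝔑) = 𝕌 * δ P + P * PowerSeries.C g := by
    rw [comm, e2, Derivation.leibniz, hδU]
    simp
  have d3 : 𝕫 * (𝔑 * δ 𝔑) + 𝕫 * (P * δ P) - 𝔽 * δ 𝔽 = 0 := by
    have := congrArg δ e3
    simp only [map_sub, map_add, pow_two, Derivation.leibniz, smul_eq_mul, hδz] at this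
    apply mul_left_cancel₀ two_ne_zero_powerSeries
    linear_combination this
  have t1 : 𝕫 * 𝔻 (zdz P) = zdz 𝔽 - 𝕫 * (𝕌 * 𝔑) - 𝕫 * (𝕌 * zdz 𝔑) - 𝕫 * 𝔻 P := by
    have := congrArg zdz e1
    simp only [zdz_sub, zdz_mul, zdz_X, zdz_C, mul_zero, add_zero] at this
    rw [coeffwise_zdz]
    linear_combination this
  have t2 : 𝔻 (zdz 𝔑) = 𝕌 * zdz P := by
    rw [coeffwise_zdz, e2, zdz_mul, zdz_C]
    simp
  have t3 : 𝕫 * 𝔑 ^ 2 + 𝕫 * P ^ 2 + 2 * (𝕫 * (𝔑 * zdz 𝔑)) + 2 * (𝕫 * (P * zdz P))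
      - 2 * (𝔽 * zdz 𝔽) = 𝕫 := by
    have := congrArg zdz e3
    simp only [zdz_sub, zdz_add, pow_two, zdz_mul, zdz_X] at this
    linear_combination this
  -- `Q` is the determinant with rows `(F, P, N)`, `(δF, δP, δN)` and `(2θF - F, 2θP, 2θN)`, where
  -- `P = F'` and `θ = z d/dz`. The correction `-F` comes from the rescaling `f = z^{-1/2} F`, which
  -- gives the first integral the constant form `N² + P² - f²`: `2θF - F = z^{1/2} · 2θf`.
  refine ⟨𝔽 * (δ P * (2 * zdz 𝔑) - δ 𝔑 * (2 * zdz P))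
    - P * (δ 𝔽 * (2 * zdz 𝔑) - δ 𝔑 * (2 * zdz 𝔽 - 𝔽))
    + 𝔑 * (δ 𝔽 * (2 * zdz P) - δ P * (2 * zdz 𝔽 - 𝔽)), ?_⟩
  have h𝔽 : 𝔻 (δ 𝔽) = δ P := comm _
  have hθ𝔽 : 𝔻 (zdz 𝔽) = zdz P := coeffwise_zdz _ _
  have h2 : 𝔻 (2 : PowerSeries DiffPoly) = 0 := by
    have : (2 : PowerSeries DiffPoly) = PowerSeries.C (C 2) := by rw [C_two, map_ofNat]
    rw [this, coeffwise_C, totalD_C, map_zero]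
  -- The relations for `P'` and its variations are available only after multiplication by `z`.
  apply mul_left_cancel₀ (PowerSeries.X_ne_zero (R := DiffPoly))
  simp only [map_sub, map_add, Derivation.leibniz, smul_eq_mul, h𝔽, hθ𝔽, h2, d2, t2, e2, ← hP]
  linear_combination (𝔽 * (2 * zdz 𝔑) - 𝔑 * (2 * zdz 𝔽 - 𝔽)) * d1
    + (2 * 𝔑 * δ 𝔽 - 2 * 𝔽 * δ 𝔑) * t1
    - (δ 𝔽 * (2 * zdz 𝔑) - δ 𝔑 * (2 * zdz 𝔽 - 𝔽) + (2 * 𝔑 * δ 𝔽 - 2 * 𝔽 * δ 𝔑)) * e1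
    + PowerSeries.C g * (2 * zdz 𝔽 - 𝔽) * e3 - PowerSeries.C g * 𝔽 * (t3 - e3)
    + 𝔑 * d3 - δ 𝔑 * e3

/-- The gradient of `N_n` is `(2 n - 1) E ρ_n`. -/
theorem euler_flux (n : ℕ) : euler (flux n) = C (2 * n - 1 : ℝ) * grad n := by
  -- The direction of variation is the discrepancy itself. Comparing the first variation formula
  -- with the trace identity shows that `g · g` is exact, hence `g = 0`.
  set g := euler (flux n) - C (2 * n - 1 : ℝ) * grad n with hg
  obtain ⟨Q, hQ⟩ := exists_evolve_fluxSeries g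
  obtain ⟨R, hR⟩ := exists_evolve_eq g (flux n)
  have h1 := congrArg (PowerSeries.coeff n) hQ
  have h2 : (2 : PowerSeries DiffPoly) = PowerSeries.C 2 := by rw [map_ofNat]
  simp only [coeff_coeffwise, fluxSeries, PowerSeries.coeff_mk, map_sub, h2,
    PowerSeries.coeff_C_mul, gradSeries, coeff_zdz] at h1
  refine sub_eq_zero.1 (eq_zero_of_sq_eq_totalD (h := -R - PowerSeries.coeff n Q) ?_)
  have h3 : (C (2 * n - 1 : ℝ) : DiffPoly) = 2 * n - 1 := by
    rw [map_sub, map_mul, map_natCast, C_two, C_1]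
  rw [map_sub, map_neg, ← hg]
  rw [hR] at h1
  rw [h3] at hg
  linear_combination (-1 : DiffPoly) * h1 - g * hg

/-! ### Lowest terms and the densities `ρ_n = N_n / (2n - 1)` -/

theorem grad_one : grad 1 = X 0 := by
  simp [grad_succ, grad_zero, flux_zero]

theorem flux_one : flux 1 = C (1 / 2 : ℝ) * X 0 ^ 2 := by
  apply eq_of_totalD_eq
  · rw [totalD_flux, grad_one, totalD_C_mul, Derivation.leibniz_pow]
    have : (C (1 / 2 : ℝ) : DiffPoly) * 2 = 1 := by
      rw [← C_two, ← C_mul]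
      norm_num
    simp only [totalD_X, smul_eq_mul, nsmul_eq_mul]
    push_cast
    linear_combination (- X 0 * X 1) * this
  · simp [constantCoeff_flux_succ]

theorem exists_isMKdVHierarchy : ∃ ρ N : ℕ → DiffPoly, IsMKdVHierarchy ρ N := by
  have heuler : ∀ j : ℕ, 1 ≤ j → euler (C ((2 * j - 1 : ℝ)⁻¹) * flux j) = grad j := by
    intro j hj
    have hj' : (1 : ℝ) ≤ j := by exact_mod_cast hj
    have hne : (2 * j - 1 : ℝ) ≠ 0 := by linarith
    rw [euler_C_mul, euler_flux, ← mul_assoc, ← C_mul, inv_mul_cancel₀ hne, C_1, one_mul]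
  have hconst : ∀ j : ℕ, 1 ≤ j → constantCoeff (flux j) = 0 := by
    rintro (_ | j) hj
    · omega
    · exact constantCoeff_flux_succ j
  refine ⟨fun j => C ((2 * j - 1 : ℝ)⁻¹) * flux j, flux, ?_, ?_, ?_, hconst, ?_, ?_⟩
  · simp only [flux_one]
    norm_num
  · intro j hj
    rw [heuler j hj, totalD_flux]
  · intro j hj
    rw [heuler j hj, heuler (j + 1) (by omega), grad_succ, map_add]
  · intro j hj
    simp [hconst j hj]
  · intro j hj
    rw [heuler j hj, constantCoeff_grad]

end

section

open Set

/-! ### Smooth functions on a strip -/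

section Strip

variable {E : Type*} [NormedAddCommGroup E] [NormedSpace ℝ E]

/-- The strip `ℝ × (-ε, ε)`. -/
def strip (ε : ℝ) : Set (ℝ × ℝ) := univ ×ˢ Ioo (-ε) ε

theorem isOpen_strip (ε : ℝ) : IsOpen (strip ε) := isOpen_univ.prod isOpen_Ioo

/-- Joint smoothness in `(x, t)` for `|t| < ε`. -/
def SmoothOnStrip (ε : ℝ) (F : ℝ → ℝ → E) : Prop :=
  ContDiffOn ℝ ∞ (fun z : ℝ × ℝ => F z.1 z.2) (strip ε)

variable {ε : ℝ} {F : ℝ → ℝ → E}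

theorem mk_mem_strip {t : ℝ} (ht : t ∈ Ioo (-ε) ε) (x : ℝ) : (x, t) ∈ strip ε :=
  ⟨mem_univ _, ht⟩

theorem SmoothOnStrip.contDiffAt (hF : SmoothOnStrip ε F) {t : ℝ} (ht : t ∈ Ioo (-ε) ε) (x : ℝ) :
    ContDiffAt ℝ ∞ (fun z : ℝ × ℝ => F z.1 z.2) (x, t) :=
  ContDiffOn.contDiffAt hF ((isOpen_strip ε).mem_nhds (mk_mem_strip ht x))

theorem SmoothOnStrip.hasFDerivAt (hF : SmoothOnStrip ε F) {t : ℝ} (ht : t ∈ Ioo (-ε) ε)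
    (x : ℝ) : HasFDerivAt (fun z : ℝ × ℝ => F z.1 z.2)
      (fderiv ℝ (fun z : ℝ × ℝ => F z.1 z.2) (x, t)) (x, t) :=
  ((hF.contDiffAt ht x).differentiableAt (by simp)).hasFDerivAt

theorem SmoothOnStrip.hasDerivAt_fst (hF : SmoothOnStrip ε F) {t : ℝ} (ht : t ∈ Ioo (-ε) ε)
    (x : ℝ) : HasDerivAt (fun y => F y t)
      (fderiv ℝ (fun z : ℝ × ℝ => F z.1 z.2) (x, t) (1, 0)) x :=
  HasFDerivAt.comp_hasDerivAt (l := fun z : ℝ × ℝ => F z.1 z.2) (f := fun y => (y, t)) x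
    (hF.hasFDerivAt ht x) ((hasDerivAt_id x).prodMk (hasDerivAt_const x t))

theorem SmoothOnStrip.hasDerivAt_snd (hF : SmoothOnStrip ε F) {t : ℝ} (ht : t ∈ Ioo (-ε) ε)
    (x : ℝ) : HasDerivAt (F x)
      (fderiv ℝ (fun z : ℝ × ℝ => F z.1 z.2) (x, t) (0, 1)) t :=
  HasFDerivAt.comp_hasDerivAt (l := fun z : ℝ × ℝ => F z.1 z.2) (f := fun τ => (x, τ)) t
    (hF.hasFDerivAt ht x) ((hasDerivAt_const t x).prodMk (hasDerivAt_id t))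

theorem SmoothOnStrip.hasDerivAt_t (hF : SmoothOnStrip ε F) {t : ℝ} (ht : t ∈ Ioo (-ε) ε)
    (x : ℝ) : HasDerivAt (F x) (deriv (F x) t) t :=
  (hF.hasDerivAt_snd ht x).differentiableAt.hasDerivAt

theorem SmoothOnStrip.fderiv_apply (hF : SmoothOnStrip ε F) (v : ℝ × ℝ) :
    ContDiffOn ℝ ∞ (fun z => fderiv ℝ (fun z : ℝ × ℝ => F z.1 z.2) z v) (strip ε) :=
  ((contDiffOn_infty_iff_fderiv_of_isOpen (isOpen_strip ε)).1 hF).2.clm_apply contDiffOn_const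

theorem SmoothOnStrip.deriv_x (hF : SmoothOnStrip ε F) :
    SmoothOnStrip ε fun x t => deriv (fun y => F y t) x :=
  (hF.fderiv_apply (1, 0)).congr fun z hz => (hF.hasDerivAt_fst hz.2 z.1).deriv

theorem SmoothOnStrip.deriv_t (hF : SmoothOnStrip ε F) :
    SmoothOnStrip ε fun x t => deriv (F x) t :=
  (hF.fderiv_apply (0, 1)).congr fun z hz => (hF.hasDerivAt_snd hz.2 z.1).deriv

theorem SmoothOnStrip.contDiff_slice (hF : SmoothOnStrip ε F) {t : ℝ} (ht : t ∈ Ioo (-ε) ε) :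
    ContDiff ℝ ∞ fun x => F x t := by
  rw [contDiff_iff_contDiffAt]
  intro x
  exact (hF.contDiffAt ht x).comp x (contDiff_id.prodMk contDiff_const).contDiffAt

/-- Mixed partial derivatives commute. -/
theorem SmoothOnStrip.deriv_comm (hF : SmoothOnStrip ε F) {t : ℝ} (ht : t ∈ Ioo (-ε) ε) (x : ℝ) :
    deriv (fun τ => deriv (fun y => F y τ) x) t = deriv (fun y => deriv (F y) t) x := by
  set Fu := fun z : ℝ × ℝ => F z.1 z.2 with hFu
  have hd : DifferentiableAt ℝ (fderiv ℝ Fu) (x, t) :=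
    ((((contDiffOn_infty_iff_fderiv_of_isOpen (isOpen_strip ε)).1 hF).2.contDiffAt
      ((isOpen_strip ε).mem_nhds (mk_mem_strip ht x))).differentiableAt (by simp))
  have hsymm : IsSymmSndFDerivAt ℝ Fu (x, t) :=
    (hF.contDiffAt ht x).isSymmSndFDerivAt (by
      rw [minSmoothness_of_isRCLikeNormedField]
      exact WithTop.coe_le_coe.2 (le_top : (2 : ℕ∞) ≤ ⊤))
  have h1 : deriv (fun τ => deriv (fun y => F y τ) x) t =
      fderiv ℝ (fderiv ℝ Fu) (x, t) (0, 1) (1, 0) := by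
    have he : (fun τ => deriv (fun y => F y τ) x) =ᶠ[nhds t]
        fun τ => fderiv ℝ Fu (x, τ) (1, 0) := by
      filter_upwards [isOpen_Ioo.mem_nhds ht] with τ hτ
      exact (hF.hasDerivAt_fst hτ x).deriv
    rw [he.deriv_eq]
    have h := hd.hasFDerivAt.comp_hasDerivAt t
      ((hasDerivAt_const t x).prodMk (hasDerivAt_id t))
    exact ((ContinuousLinearMap.apply ℝ E ((1, 0) : ℝ × ℝ)).hasFDerivAt.comp_hasDerivAt t h).deriv
  have h2 : deriv (fun y => deriv (F y) t) x =
      fderiv ℝ (fderiv ℝ Fu) (x, t) (1, 0) (0, 1) := by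
    have he : (fun y => deriv (F y) t) = fun y => fderiv ℝ Fu (y, t) (0, 1) :=
      funext fun y => (hF.hasDerivAt_snd ht y).deriv
    rw [he]
    have h := hd.hasFDerivAt.comp_hasDerivAt x
      ((hasDerivAt_id x).prodMk (hasDerivAt_const x t))
    exact ((ContinuousLinearMap.apply ℝ E ((0, 1) : ℝ × ℝ)).hasFDerivAt.comp_hasDerivAt x h).deriv
  rw [h1, h2]
  exact hsymm (0, 1) (1, 0)

end Strip

section StripIntegral

variable {ε : ℝ} {F : ℝ → ℝ → ℝ}

/-- Differentiation under the integral sign. -/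
theorem SmoothOnStrip.hasDerivAt_integral (hF : SmoothOnStrip ε F) (L : ℝ) {t : ℝ}
    (ht : t ∈ Ioo (-ε) ε) :
    HasDerivAt (fun t => ∫ x in (0 : ℝ)..L, F x t) (∫ x in (0 : ℝ)..L, deriv (F x) t) t := by
  obtain ⟨δ, hδ, hball⟩ := Metric.nhds_basis_closedBall.mem_iff.1 (isOpen_Ioo.mem_nhds ht)
  have hcont : ∀ {τ}, τ ∈ Ioo (-ε) ε → Continuous fun x => F x τ := fun hτ =>
    (hF.contDiff_slice hτ).continuous
  have hK : IsCompact (uIcc 0 L ×ˢ Metric.closedBall t δ) :=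
    isCompact_uIcc.prod (isCompact_closedBall t δ)
  have hKs : uIcc 0 L ×ˢ Metric.closedBall t δ ⊆ strip ε := fun z hz => ⟨mem_univ _, hball hz.2⟩
  obtain ⟨C, hC⟩ := hK.exists_bound_of_continuousOn
    ((ContDiffOn.continuousOn hF.deriv_t).mono hKs)
  refine (intervalIntegral.hasDerivAt_integral_of_dominated_loc_of_deriv_le
    (F := fun t x => F x t) (F' := fun t x => deriv (F x) t) (bound := fun _ => C)
    (Metric.closedBall_mem_nhds t hδ) ?_ ?_ ?_ ?_ ?_ ?_).2
  · filter_upwards [isOpen_Ioo.mem_nhds ht] with τ hτ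
    exact (hcont hτ).aestronglyMeasurable
  · exact (hcont ht).intervalIntegrable _ _
  · exact (hF.deriv_t.contDiff_slice ht).continuous.aestronglyMeasurable
  · exact Filter.Eventually.of_forall fun x hx τ hτ => hC (x, τ) ⟨uIoc_subset_uIcc hx, hτ⟩
  · exact intervalIntegrable_const
  · exact Filter.Eventually.of_forall fun x _ τ hτ => hF.hasDerivAt_t (hball hτ) x

/-- Induction on the order of differentiability: the derivative of the integral is the integral of
`∂_t F`, which is again smooth on the strip. -/
theorem SmoothOnStrip.contDiffOn_integral (hF : SmoothOnStrip ε F) (L : ℝ) :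
    ContDiffOn ℝ ∞ (fun t => ∫ x in (0 : ℝ)..L, F x t) (Ioo (-ε) ε) := by
  rw [contDiffOn_infty]
  intro n
  induction n generalizing F with
  | zero =>
    rw [Nat.cast_zero, contDiffOn_zero]
    exact fun t ht => (hF.hasDerivAt_integral L ht).continuousAt.continuousWithinAt
  | succ n ih =>
    rw [Nat.cast_succ, contDiffOn_succ_iff_deriv_of_isOpen isOpen_Ioo]
    refine ⟨fun t ht =>
      (hF.hasDerivAt_integral L ht).differentiableAt.differentiableWithinAt, by simp, ?_⟩
    exact (ih hF.deriv_t).congr fun t ht => (hF.hasDerivAt_integral L ht).deriv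

end StripIntegral

end

section

open Set

/-! ### The Hermitian product -/

theorem herm_eq (v w : C2) :
    herm v w = v 0 * (starRingEnd ℂ) (w 0) + v 1 * (starRingEnd ℂ) (w 1) := by
  simp [herm, PiLp.inner_apply, Fin.sum_univ_two]

theorem herm_conj_symm (v w : C2) : (starRingEnd ℂ) (herm w v) = herm v w :=
  inner_conj_symm w v

theorem herm_self (v : C2) : herm v v = ((‖v‖ ^ 2 : ℝ) : ℂ) := by
  rw [herm, inner_self_eq_norm_sq_to_K]
  simp

theorem hasDerivAt_herm {f g : ℝ → C2} {f' g' : C2} {x : ℝ} (hf : HasDerivAt f f' x)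
    (hg : HasDerivAt g g' x) :
    HasDerivAt (fun x => herm (f x) (g x)) (herm f' (g x) + herm (f x) g') x := by
  have h := HasDerivAt.inner ℂ hg hf
  exact h

theorem SmoothOnStrip.herm {ε : ℝ} {F G : ℝ → ℝ → C2} (hF : SmoothOnStrip ε F)
    (hG : SmoothOnStrip ε G) : SmoothOnStrip ε fun x t => LegendrianMKdV.herm (F x t) (G x t) :=
  ContDiffOn.inner ℂ hG hF

/-- A vector that is Hermitian orthogonal to a unit vector `γ` is a multiple of `(-γ̄₁, γ̄₀)`. -/
theorem exists_coords_of_herm_eq_zero {γ e : C2} (hγ : ‖γ‖ = 1) (he : herm e γ = 0) :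
    ∃ d : ℂ, e 0 = -(starRingEnd ℂ) (γ 1) * d ∧ e 1 = (starRingEnd ℂ) (γ 0) * d := by
  have h1 : γ 0 * (starRingEnd ℂ) (γ 0) + γ 1 * (starRingEnd ℂ) (γ 1) = 1 := by
    rw [← herm_eq, herm_self, hγ]
    simp
  rw [herm_eq] at he
  refine ⟨γ 0 * e 1 - γ 1 * e 0, ?_, ?_⟩
  · linear_combination (-e 0) * h1 + γ 0 * he
  · linear_combination (-e 1) * h1 + γ 1 * he

/-- Parseval's identity in the frame `(γ, e)`. -/
theorem norm_sq_mul_herm {γ e : C2} (hγ : ‖γ‖ = 1) (he : herm e γ = 0) (v w : C2) :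
    ((‖e‖ ^ 2 : ℝ) : ℂ) * herm v w =
      herm v e * herm e w + ((‖e‖ ^ 2 : ℝ) : ℂ) * (herm v γ * herm γ w) := by
  obtain ⟨d, h0, h1⟩ := exists_coords_of_herm_eq_zero hγ he
  have h2 : γ 0 * (starRingEnd ℂ) (γ 0) + γ 1 * (starRingEnd ℂ) (γ 1) = 1 := by
    rw [← herm_eq, herm_self, hγ]
    simp
  rw [← herm_self]
  simp only [herm_eq, h0, h1, map_mul, map_neg, Complex.conj_conj]
  linear_combination (-(d * (starRingEnd ℂ) d
    * (v 0 * (starRingEnd ℂ) (γ 0) + v 1 * (starRingEnd ℂ) (γ 1))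
    * (γ 0 * (starRingEnd ℂ) (w 0) + γ 1 * (starRingEnd ℂ) (w 1)))) * h2

/-- The vectors `γ, e` occupy two slots, so only the `iγ` and `ie` components of `v` and `w`
survive, and these are read off from imaginary parts of Hermitian products. In particular multiples
of `γ_x` are invisible to `Omega`. -/
theorem detR_eq {γ e : C2} (hγ : ‖γ‖ = 1) (he : herm e γ = 0) (v w : C2) :
    detR γ e v w = (herm v e).im * (herm w γ).im - (herm v γ).im * (herm w e).im := by
  obtain ⟨d, h0, h1⟩ := exists_coords_of_herm_eq_zero hγ he
  simp only [detR, Matrix.det_transpose, herm_eq, h0, h1]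
  have s12 : Fin.succAbove (1 : Fin 4) 2 = 3 := rfl
  have s22 : Fin.succAbove (2 : Fin 4) 2 = 3 := rfl
  have s32 : Fin.succAbove (3 : Fin 4) 2 = 2 := rfl
  simp [Matrix.det_succ_row_zero, Fin.sum_univ_succ, realCoords, h0, h1, s12, s22, s32]
  ring

end

section

open Set

/-! ### The curvature jet of a loop -/

/-- The `j`-th arclength derivative of the curvature. -/
def curvJet (γ : ℝ → C2) (j : ℕ) : ℝ → ℝ := (arcDeriv γ)^[j] (curvature γ)

theorem curvJet_zero (γ : ℝ → C2) : curvJet γ 0 = curvature γ := rfl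

theorem curvJet_succ (γ : ℝ → C2) (j : ℕ) :
    curvJet γ (j + 1) = arcDeriv γ (curvJet γ j) :=
  Function.iterate_succ_apply' _ _ _

theorem evalCurv_eq (P : DiffPoly) (γ : ℝ → C2) (x : ℝ) :
    evalCurv P γ x = MvPolynomial.eval (fun j => curvJet γ j x) P := rfl

@[simp] theorem evalCurv_add (P Q : DiffPoly) (γ : ℝ → C2) (x : ℝ) :
    evalCurv (P + Q) γ x = evalCurv P γ x + evalCurv Q γ x := map_add _ _ _

@[simp] theorem evalCurv_sub (P Q : DiffPoly) (γ : ℝ → C2) (x : ℝ) :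
    evalCurv (P - Q) γ x = evalCurv P γ x - evalCurv Q γ x := map_sub _ _ _

@[simp] theorem evalCurv_neg (P : DiffPoly) (γ : ℝ → C2) (x : ℝ) :
    evalCurv (-P) γ x = -evalCurv P γ x := map_neg _ _

@[simp] theorem evalCurv_mul (P Q : DiffPoly) (γ : ℝ → C2) (x : ℝ) :
    evalCurv (P * Q) γ x = evalCurv P γ x * evalCurv Q γ x := map_mul _ _ _

@[simp] theorem evalCurv_C (a : ℝ) (γ : ℝ → C2) (x : ℝ) :
    evalCurv (MvPolynomial.C a) γ x = a := MvPolynomial.eval_C a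

@[simp] theorem evalCurv_X (j : ℕ) (γ : ℝ → C2) (x : ℝ) :
    evalCurv (MvPolynomial.X j) γ x = curvJet γ j x := MvPolynomial.eval_X j

theorem evalCurv_sum (s : Finset ℕ) (P : ℕ → DiffPoly) (γ : ℝ → C2) (x : ℝ) :
    evalCurv (∑ j ∈ s, P j) γ x = ∑ j ∈ s, evalCurv (P j) γ x := map_sum _ _ _

/-- Chain rule for the evaluation of a polynomial along a curve. -/
theorem hasDerivAt_eval {k : ℝ → ℕ → ℝ} {k' : ℕ → ℝ} {t : ℝ}
    (hk : ∀ j, HasDerivAt (fun t => k t j) (k' j) t) (P : DiffPoly) :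
    HasDerivAt (fun t => MvPolynomial.eval (k t) P)
      (∑ j ∈ P.vars, MvPolynomial.eval (k t) (MvPolynomial.pderiv j P) * k' j) t := by
  -- Summing over all sufficiently long ranges keeps the induction on `P` free of the variable sets
  -- of sums and products.
  have key : ∃ n, ∀ m, n ≤ m → HasDerivAt (fun t => MvPolynomial.eval (k t) P)
      (∑ j ∈ Finset.range m, MvPolynomial.eval (k t) (MvPolynomial.pderiv j P) * k' j) t := by
    induction P using MvPolynomial.induction_on with
    | C a =>
      refine ⟨0, fun m _ => ?_⟩
      simpa using hasDerivAt_const t a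
    | add P Q hP hQ =>
      obtain ⟨a, ha⟩ := hP
      obtain ⟨b, hb⟩ := hQ
      refine ⟨max a b, fun m hm => ?_⟩
      have h := (ha m (by omega)).add (hb m (by omega))
      rw [← Finset.sum_add_distrib] at h
      simpa [add_mul, Pi.add_def] using h
    | mul_X P i hP =>
      obtain ⟨a, ha⟩ := hP
      refine ⟨max a (i + 1), fun m hm => ?_⟩
      have h := (ha m (by omega)).mul (hk i)
      have hi : i ∈ Finset.range m := by simp; omega
      have e : (fun t => MvPolynomial.eval (k t) (P * MvPolynomial.X i)) =
          (fun t => MvPolynomial.eval (k t) P) * fun t => k t i := by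
        ext t
        simp
      rw [e]
      refine h.congr_deriv (Eq.symm ?_)
      simp only [MvPolynomial.pderiv_mul, MvPolynomial.pderiv_X, map_add, map_mul,
        MvPolynomial.eval_X, add_mul, Finset.sum_add_distrib, Finset.sum_mul]
      congr 1
      · exact Finset.sum_congr rfl fun j _ => by ring
      · rw [Finset.sum_eq_single_of_mem i hi]
        · simp
        · intro j _ hj
          simp [hj.symm]
  obtain ⟨n, hn⟩ := key
  obtain ⟨m, hm⟩ := vars_subset_range P
  have h := hn (max n m) (le_max_left _ _)
  rwa [← Finset.sum_subset (hm (max n m) (le_max_right _ _))] at h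
  intro j _ hj
  rw [MvPolynomial.pderiv_eq_zero_of_notMem_vars hj]
  simp

/-! ### Smooth families -/

section Family

variable {L ε : ℝ} {Γ : ℝ → ℝ → C2}

theorem IsSmoothFamily.smoothOnStrip (h : IsSmoothFamily L ε Γ) : SmoothOnStrip ε Γ := h.smooth

theorem IsLegendrianLoop.speed_pos {γ : ℝ → C2} (h : IsLegendrianLoop L γ) (x : ℝ) :
    0 < speed γ x := norm_pos_iff.2 (h.regular x)

theorem IsSmoothFamily.smoothOnStrip_speed (h : IsSmoothFamily L ε Γ) :
    SmoothOnStrip ε fun x t => speed (fun y => Γ y t) x :=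
  ContDiffOn.norm ℂ h.smoothOnStrip.deriv_x fun z hz => (h.loop z.2 hz.2).regular z.1

theorem IsSmoothFamily.smoothOnStrip_curvature (h : IsSmoothFamily L ε Γ) :
    SmoothOnStrip ε fun x t => curvature (fun y => Γ y t) x := by
  have h1 := h.smoothOnStrip.deriv_x
  have h2 : SmoothOnStrip ε fun x t =>
      (herm (deriv (deriv (fun y => Γ y t)) x) (deriv (fun y => Γ y t) x)).im :=
    Complex.imCLM.contDiff.comp_contDiffOn (h1.deriv_x.herm h1)
  exact ContDiffOn.div h2 (ContDiffOn.pow h.smoothOnStrip_speed 3)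
    fun z hz => (pow_pos ((h.loop z.2 hz.2).speed_pos z.1) 3).ne'

theorem IsSmoothFamily.smoothOnStrip_arcDeriv (h : IsSmoothFamily L ε Γ) {g : ℝ → ℝ → ℝ}
    (hg : SmoothOnStrip ε g) :
    SmoothOnStrip ε fun x t => arcDeriv (fun y => Γ y t) (fun y => g y t) x :=
  ContDiffOn.mul (ContDiffOn.inv h.smoothOnStrip_speed
    fun z hz => ((h.loop z.2 hz.2).speed_pos z.1).ne') hg.deriv_x

theorem IsSmoothFamily.smoothOnStrip_curvJet (h : IsSmoothFamily L ε Γ) (j : ℕ) :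
    SmoothOnStrip ε fun x t => curvJet (fun y => Γ y t) j x := by
  induction j with
  | zero => exact h.smoothOnStrip_curvature
  | succ j ih =>
    simp only [curvJet_succ]
    exact h.smoothOnStrip_arcDeriv ih

theorem IsSmoothFamily.smoothOnStrip_evalCurv (h : IsSmoothFamily L ε Γ) (P : DiffPoly) :
    SmoothOnStrip ε fun x t => evalCurv P (fun y => Γ y t) x := by
  induction P using MvPolynomial.induction_on with
  | C a =>
    simp only [evalCurv_C]
    exact contDiffOn_const
  | add P Q hP hQ =>
    simp only [evalCurv_add]
    exact ContDiffOn.add hP hQ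
  | mul_X P i hP =>
    simp only [evalCurv_mul, evalCurv_X]
    exact ContDiffOn.mul hP (h.smoothOnStrip_curvJet i)

/-- Lets smoothness along a single loop be read off from smoothness on strips. -/
theorem IsLegendrianLoop.constFamily {γ : ℝ → C2} (h : IsLegendrianLoop L γ) :
    IsSmoothFamily L 1 fun x _ => γ x where
  smooth := (h.smooth.comp contDiff_fst).contDiffOn
  loop := fun _ _ => h

end Family

/-! ### Periodic functions along a loop -/

/-- Smooth functions of period `L`. -/
structure SmoothPeriodic (L : ℝ) (f : ℝ → ℝ) : Prop where
  smooth : ContDiff ℝ ∞ f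
  periodic : Function.Periodic f L

theorem periodic_deriv {E : Type*} [NormedAddCommGroup E] [NormedSpace ℝ E] {f : ℝ → E} {L : ℝ}
    (h : Function.Periodic f L) : Function.Periodic (deriv f) L := by
  intro x
  rw [← deriv_comp_add_const]
  congr 1
  exact funext h

namespace SmoothPeriodic

variable {L : ℝ} {f g : ℝ → ℝ}

theorem add (hf : SmoothPeriodic L f) (hg : SmoothPeriodic L g) :
    SmoothPeriodic L fun x => f x + g x :=
  ⟨hf.smooth.add hg.smooth, hf.periodic.add hg.periodic⟩

theorem sub (hf : SmoothPeriodic L f) (hg : SmoothPeriodic L g) :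
    SmoothPeriodic L fun x => f x - g x :=
  ⟨hf.smooth.sub hg.smooth, hf.periodic.sub hg.periodic⟩

theorem mul (hf : SmoothPeriodic L f) (hg : SmoothPeriodic L g) :
    SmoothPeriodic L fun x => f x * g x :=
  ⟨hf.smooth.mul hg.smooth, hf.periodic.mul hg.periodic⟩

theorem const_mul (c : ℝ) (hf : SmoothPeriodic L f) : SmoothPeriodic L fun x => c * f x :=
  ⟨contDiff_const.mul hf.smooth, fun x => by simp only [hf.periodic x]⟩

theorem sum {s : Finset ℕ} {F : ℕ → ℝ → ℝ} (h : ∀ j ∈ s, SmoothPeriodic L (F j)) :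
    SmoothPeriodic L fun x => ∑ j ∈ s, F j x :=
  ⟨ContDiff.sum fun j hj => (h j hj).smooth,
    fun x => Finset.sum_congr rfl fun j hj => (h j hj).periodic x⟩

theorem differentiableAt (hf : SmoothPeriodic L f) (x : ℝ) : DifferentiableAt ℝ f x :=
  hf.smooth.differentiable (by simp) x

end SmoothPeriodic

section Loop

variable {L : ℝ} {γ : ℝ → C2}

theorem zero_mem_Ioo : (0 : ℝ) ∈ Ioo (-1 : ℝ) 1 := by norm_num

theorem IsLegendrianLoop.periodic_speed (h : IsLegendrianLoop L γ) :
    Function.Periodic (speed γ) L := fun x => by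
  simp only [speed, periodic_deriv h.periodic x]

theorem IsLegendrianLoop.smoothPeriodic_speed (h : IsLegendrianLoop L γ) :
    SmoothPeriodic L (speed γ) :=
  ⟨h.constFamily.smoothOnStrip_speed.contDiff_slice zero_mem_Ioo, h.periodic_speed⟩

theorem IsLegendrianLoop.smoothPeriodic_inv_speed (h : IsLegendrianLoop L γ) :
    SmoothPeriodic L fun x => (speed γ x)⁻¹ :=
  ⟨h.smoothPeriodic_speed.smooth.inv fun x => (h.speed_pos x).ne',
    fun x => by simp only [h.periodic_speed x]⟩

theorem smoothPeriodic_deriv {f : ℝ → ℝ} (hf : SmoothPeriodic L f) :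
    SmoothPeriodic L (deriv f) :=
  ⟨(contDiff_infty_iff_deriv.1 hf.smooth).2, periodic_deriv hf.periodic⟩

theorem IsLegendrianLoop.smoothPeriodic_arcDeriv (h : IsLegendrianLoop L γ) {f : ℝ → ℝ}
    (hf : SmoothPeriodic L f) : SmoothPeriodic L (arcDeriv γ f) :=
  h.smoothPeriodic_inv_speed.mul (smoothPeriodic_deriv hf)

theorem IsLegendrianLoop.smoothPeriodic_curvature (h : IsLegendrianLoop L γ) :
    SmoothPeriodic L (curvature γ) :=
  ⟨h.constFamily.smoothOnStrip_curvature.contDiff_slice zero_mem_Ioo, fun x => by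
    simp only [curvature, h.periodic_speed x, periodic_deriv h.periodic x,
      periodic_deriv (periodic_deriv h.periodic) x]⟩

theorem IsLegendrianLoop.smoothPeriodic_curvJet (h : IsLegendrianLoop L γ) (j : ℕ) :
    SmoothPeriodic L (curvJet γ j) := by
  induction j with
  | zero => exact h.smoothPeriodic_curvature
  | succ j ih =>
    rw [curvJet_succ]
    exact h.smoothPeriodic_arcDeriv ih

theorem IsLegendrianLoop.smoothPeriodic_evalCurv (h : IsLegendrianLoop L γ) (P : DiffPoly) :
    SmoothPeriodic L (evalCurv P γ) :=
  ⟨(h.constFamily.smoothOnStrip_evalCurv P).contDiff_slice zero_mem_Ioo, fun x => by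
    simp only [evalCurv_eq, (h.smoothPeriodic_curvJet _).periodic x]⟩

theorem IsLegendrianLoop.deriv_eq_speed_mul (h : IsLegendrianLoop L γ) (f : ℝ → ℝ) (x : ℝ) :
    deriv f x = speed γ x * arcDeriv γ f x := by
  rw [arcDeriv, mul_inv_cancel_left₀ (h.speed_pos x).ne']

theorem arcDeriv_add {f g : ℝ → ℝ} (hf : SmoothPeriodic L f) (hg : SmoothPeriodic L g) (x : ℝ) :
    arcDeriv γ (fun x => f x + g x) x = arcDeriv γ f x + arcDeriv γ g x := by
  simp only [arcDeriv]
  rw [deriv_fun_add (hf.differentiableAt x) (hg.differentiableAt x)]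
  ring

theorem arcDeriv_sub {f g : ℝ → ℝ} (hf : SmoothPeriodic L f) (hg : SmoothPeriodic L g) (x : ℝ) :
    arcDeriv γ (fun x => f x - g x) x = arcDeriv γ f x - arcDeriv γ g x := by
  simp only [arcDeriv]
  rw [deriv_fun_sub (hf.differentiableAt x) (hg.differentiableAt x)]
  ring

theorem arcDeriv_mul {f g : ℝ → ℝ} (hf : SmoothPeriodic L f) (hg : SmoothPeriodic L g) (x : ℝ) :
    arcDeriv γ (fun x => f x * g x) x = arcDeriv γ f x * g x + f x * arcDeriv γ g x := by
  simp only [arcDeriv]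
  rw [deriv_fun_mul (hf.differentiableAt x) (hg.differentiableAt x)]
  ring

theorem arcDeriv_sum {s : Finset ℕ} {F : ℕ → ℝ → ℝ} (h : ∀ j ∈ s, SmoothPeriodic L (F j))
    (x : ℝ) : arcDeriv γ (fun x => ∑ j ∈ s, F j x) x = ∑ j ∈ s, arcDeriv γ (F j) x := by
  simp only [arcDeriv]
  rw [deriv_fun_sum fun j hj => (h j hj).differentiableAt x, Finset.mul_sum]

/-- The total derivative of differential polynomials is the arclength derivative. -/
theorem IsLegendrianLoop.arcDeriv_evalCurv (h : IsLegendrianLoop L γ) (P : DiffPoly) (x : ℝ) :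
    arcDeriv γ (evalCurv P γ) x = evalCurv (totalD P) γ x := by
  have h1 := hasDerivAt_eval (k := fun x j => curvJet γ j x) (t := x)
    (fun j => ((h.smoothPeriodic_curvJet j).differentiableAt x).hasDerivAt) P
  have h2 : deriv (evalCurv P γ) x = _ := h1.deriv
  rw [arcDeriv, h2, derivation_eq_sum_pderiv totalD (Finset.Subset.refl P.vars), evalCurv_sum,
    Finset.mul_sum]
  refine Finset.sum_congr rfl fun j _ => ?_
  rw [evalCurv_mul, totalD_X, evalCurv_X, curvJet_succ, arcDeriv, evalCurv_eq]
  ring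

theorem IsLegendrianLoop.integral_arcDeriv (h : IsLegendrianLoop L γ) {R : ℝ → ℝ}
    (hR : SmoothPeriodic L R) : ∫ x in (0 : ℝ)..L, arcDeriv γ R x * speed γ x = 0 := by
  have h1 : ∀ x, arcDeriv γ R x * speed γ x = deriv R x := fun x => by
    rw [h.deriv_eq_speed_mul R x, mul_comm]
  simp only [h1]
  rw [intervalIntegral.integral_deriv_eq_sub (fun x _ => hR.differentiableAt x)
    ((smoothPeriodic_deriv hR).smooth.continuous.intervalIntegrable _ _)]
  have := hR.periodic 0
  rw [zero_add] at this
  rw [this, sub_self]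

/-- Functions that differ by an arclength derivative have the same integral. -/
theorem IsLegendrianLoop.integral_congr_arcDeriv (h : IsLegendrianLoop L γ) {f g R : ℝ → ℝ}
    (hg : SmoothPeriodic L g) (hR : SmoothPeriodic L R)
    (hfg : ∀ x, f x = g x + arcDeriv γ R x) :
    ∫ x in (0 : ℝ)..L, f x * speed γ x = ∫ x in (0 : ℝ)..L, g x * speed γ x := by
  simp only [hfg, add_mul]
  rw [intervalIntegral.integral_add, h.integral_arcDeriv hR, add_zero]
  · exact (hg.mul h.smoothPeriodic_speed).smooth.continuous.intervalIntegrable _ _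
  · exact ((h.smoothPeriodic_arcDeriv hR).mul
      h.smoothPeriodic_speed).smooth.continuous.intervalIntegrable _ _

/-! ### The first variation of `∫ P ds` -/

/-- Integration by parts for jets whose arclength element is stretched by `h`. -/
theorem IsLegendrianLoop.exists_evalCurv_mul_eq (hγ : IsLegendrianLoop L γ) {τ : ℕ → ℝ → ℝ}
    {h : ℝ → ℝ} (hτ : ∀ j, SmoothPeriodic L (τ j))
    (hstep : ∀ j x, τ (j + 1) x = arcDeriv γ (τ j) x - h x * curvJet γ (j + 1) x)
    (j : ℕ) (Q : DiffPoly) :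
    ∃ R, SmoothPeriodic L R ∧ ∀ x, evalCurv Q γ x * τ j x =
      evalCurv (negD^[j] Q) γ x * τ 0 x - h x * evalCurv (noether j Q) γ x + arcDeriv γ R x := by
  induction j generalizing Q with
  | zero =>
    refine ⟨fun _ => 0, ⟨contDiff_const, fun _ => rfl⟩, fun x => ?_⟩
    have : evalCurv 0 γ x = 0 := map_zero _
    simp [noether, arcDeriv, this]
  | succ j ih =>
    obtain ⟨R, hR, hRx⟩ := ih (negD Q)
    have hQτ := (hγ.smoothPeriodic_evalCurv Q).mul (hτ j)
    refine ⟨_, hR.add hQτ, fun x => ?_⟩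
    rw [arcDeriv_add hR hQτ, arcDeriv_mul (hγ.smoothPeriodic_evalCurv Q) (hτ j), hstep,
      hγ.arcDeriv_evalCurv, noether, Function.iterate_succ_apply]
    have h1 := hRx x
    have h2 : evalCurv (negD Q) γ x = -evalCurv (totalD Q) γ x := by simp [negD]
    rw [h2] at h1
    simp only [evalCurv_add, evalCurv_mul, evalCurv_X]
    linear_combination h1

/-- The gradient of `∫ P ds` with respect to the normal component of the variation. -/
def normalGrad (P : DiffPoly) : DiffPoly :=
  totalD (totalD (euler P)) + MvPolynomial.X 0 ^ 2 * euler P + MvPolynomial.C 4 * euler P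
    - MvPolynomial.X 0 * energy P

/-- Here `τ j` stands for the variation of the `j`-th curvature derivative and `h` for that of `ds`
relative to `ds`. With `G = energy P`, the integrand reduces to `E τ₀ + hG` modulo exact terms. The
`a`-terms form `(aG)_s` because `G_s = κ_s E`, and two integrations by parts move the derivatives
off `b`. -/
theorem IsLegendrianLoop.integral_variation (hγ : IsLegendrianLoop L γ) {τ : ℕ → ℝ → ℝ}
    {h a b : ℝ → ℝ} (hτ : ∀ j, SmoothPeriodic L (τ j))
    (ha : SmoothPeriodic L a) (hb : SmoothPeriodic L b)
    (hstep : ∀ j x, τ (j + 1) x = arcDeriv γ (τ j) x - h x * curvJet γ (j + 1) x)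
    (hh : ∀ x, h x = arcDeriv γ a x - curvature γ x * b x)
    (hτ0 : ∀ x, τ 0 x = a x * arcDeriv γ (curvature γ) x + arcDeriv γ (arcDeriv γ b) x
      + curvature γ x ^ 2 * b x + 4 * b x) (P : DiffPoly) :
    ∫ x in (0 : ℝ)..L, (∑ j ∈ P.vars, evalCurv (MvPolynomial.pderiv j P) γ x * τ j x
      + h x * evalCurv P γ x) * speed γ x =
    ∫ x in (0 : ℝ)..L, (b x * evalCurv (normalGrad P) γ x) * speed γ x := by
  choose R hR hRx using fun j => hγ.exists_evalCurv_mul_eq hτ hstep j (MvPolynomial.pderiv j P)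
  have hE := hγ.smoothPeriodic_evalCurv (euler P)
  have hDE := hγ.smoothPeriodic_evalCurv (totalD (euler P))
  have hG := hγ.smoothPeriodic_evalCurv (energy P)
  have hRs := SmoothPeriodic.sum (s := P.vars) fun j _ => hR j
  have hb' := hγ.smoothPeriodic_arcDeriv hb
  refine hγ.integral_congr_arcDeriv
    (R := fun x => (∑ j ∈ P.vars, R j x) + (a x * evalCurv (energy P) γ x
      + (arcDeriv γ b x * evalCurv (euler P) γ x - b x * evalCurv (totalD (euler P)) γ x)))
    (hb.mul (hγ.smoothPeriodic_evalCurv _))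
    (hRs.add ((ha.mul hG).add ((hb'.mul hE).sub (hb.mul hDE)))) fun x => ?_
  rw [arcDeriv_add hRs ((ha.mul hG).add ((hb'.mul hE).sub (hb.mul hDE))),
    arcDeriv_add (ha.mul hG) ((hb'.mul hE).sub (hb.mul hDE)),
    arcDeriv_sub (hb'.mul hE) (hb.mul hDE), arcDeriv_mul ha hG, arcDeriv_mul hb' hE,
    arcDeriv_mul hb hDE, arcDeriv_sum fun j _ => hR j]
  simp only [hγ.arcDeriv_evalCurv, totalD_energy]
  -- The `noether` terms sum to `P - G`, so they replace `hP` by `hG`.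
  have h1 : ∑ j ∈ P.vars, evalCurv (MvPolynomial.pderiv j P) γ x * τ j x =
      evalCurv (euler P) γ x * τ 0 x + h x * (evalCurv (energy P) γ x - evalCurv P γ x)
        + ∑ j ∈ P.vars, arcDeriv γ (R j) x := by
    rw [euler_eq_sum (Finset.Subset.refl P.vars), energy, evalCurv_sub, evalCurv_sum,
      evalCurv_sum, Finset.sum_mul, sub_sub_cancel_left, mul_neg, Finset.mul_sum,
      ← Finset.sum_neg_distrib, ← Finset.sum_add_distrib, ← Finset.sum_add_distrib]
    exact Finset.sum_congr rfl fun j _ => by rw [hRx j x]; ring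
  have hκ1 : curvJet γ 1 x = arcDeriv γ (curvature γ) x := by
    rw [curvJet_succ, curvJet_zero]
  rw [h1, hτ0, hh]
  simp only [normalGrad, evalCurv_add, evalCurv_sub, evalCurv_mul, evalCurv_X, evalCurv_C, pow_two,
    curvJet_zero, hκ1]
  ring

end Loop

end

section

open Set

/-! ### Structure equations of a Legendrian loop -/

section Structure

variable {L : ℝ} {γ : ℝ → C2}

theorem IsLegendrianLoop.hasDerivAt (h : IsLegendrianLoop L γ) (x : ℝ) :
    HasDerivAt γ (deriv γ x) x :=
  (h.smooth.differentiable (by simp) x).hasDerivAt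

theorem IsLegendrianLoop.contDiff_deriv (h : IsLegendrianLoop L γ) : ContDiff ℝ ∞ (deriv γ) :=
  (contDiff_infty_iff_deriv.1 h.smooth).2

theorem IsLegendrianLoop.hasDerivAt_deriv (h : IsLegendrianLoop L γ) (x : ℝ) :
    HasDerivAt (deriv γ) (deriv (deriv γ) x) x :=
  (h.contDiff_deriv.differentiable (by simp) x).hasDerivAt

theorem IsLegendrianLoop.hasDerivAt_speed (h : IsLegendrianLoop L γ) (x : ℝ) :
    HasDerivAt (speed γ) (deriv (speed γ) x) x :=
  (h.smoothPeriodic_speed.differentiableAt x).hasDerivAt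

theorem herm_deriv_self (γ : ℝ → C2) (x : ℝ) :
    herm (deriv γ x) (deriv γ x) = ((speed γ x ^ 2 : ℝ) : ℂ) := herm_self _

theorem IsLegendrianLoop.herm_second_deriv (h : IsLegendrianLoop L γ) (x : ℝ) :
    herm (deriv (deriv γ) x) (γ x) = -((speed γ x ^ 2 : ℝ) : ℂ) := by
  have h1 := hasDerivAt_herm (h.hasDerivAt_deriv x) (h.hasDerivAt x)
  have h2 : (fun x => herm (deriv γ x) (γ x)) = fun _ => 0 := funext h.legendrian
  rw [h2] at h1
  have h3 := h1.unique (hasDerivAt_const x (0 : ℂ))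
  rw [herm_deriv_self] at h3
  linear_combination h3

/-- The real part comes from differentiating `⟨γ_x, γ_x⟩ = speed²`; the imaginary part is the
definition of the curvature. -/
theorem IsLegendrianLoop.herm_second_deriv_deriv (h : IsLegendrianLoop L γ) (x : ℝ) :
    herm (deriv (deriv γ) x) (deriv γ x) =
      ((speed γ x * deriv (speed γ) x : ℝ) : ℂ)
        + ((curvature γ x * speed γ x ^ 3 : ℝ) : ℂ) * Complex.I := by
  have hpos := h.speed_pos x
  apply Complex.ext
  · have h1 := hasDerivAt_herm (h.hasDerivAt_deriv x) (h.hasDerivAt_deriv x)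
    have h2 : (fun x => herm (deriv γ x) (deriv γ x)) =
        fun x => ((speed γ x ^ 2 : ℝ) : ℂ) := funext (herm_deriv_self γ)
    rw [h2] at h1
    have h3 := h1.unique ((h.hasDerivAt_speed x).pow 2).ofReal_comp
    rw [← herm_conj_symm (deriv γ x) (deriv (deriv γ) x)] at h3
    have h4 := congrArg Complex.re h3
    simp only [Complex.add_re, Complex.conj_re, Complex.ofReal_re] at h4
    simp only [Complex.add_re, Complex.ofReal_re, Complex.re_ofReal_mul, Complex.I_re, mul_zero,
      add_zero]
    norm_num at h4
    linarith
  · simp only [Complex.add_im, Complex.ofReal_im, Complex.im_ofReal_mul, Complex.I_im, mul_one,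
      zero_add, curvature]
    field_simp

/-- Expansion of `⟨v, γ_xx⟩` in the frame `(γ, γ_x)`. -/
theorem IsLegendrianLoop.herm_right_second_deriv (h : IsLegendrianLoop L γ) (x : ℝ) (v : C2) :
    herm v (deriv (deriv γ) x) =
      herm v (deriv γ x) * ((arcDeriv γ (speed γ) x : ℂ)
        - ((curvature γ x * speed γ x : ℝ) : ℂ) * Complex.I)
      - ((speed γ x ^ 2 : ℝ) : ℂ) * herm v (γ x) := by
  have hpos := h.speed_pos x
  have hne : ((speed γ x : ℝ) : ℂ) ≠ 0 := by exact_mod_cast hpos.ne'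
  have h1 := norm_sq_mul_herm (h.sphere x) (h.legendrian x) v (deriv (deriv γ) x)
  rw [← herm_conj_symm (deriv γ x) (deriv (deriv γ) x), h.herm_second_deriv_deriv,
    ← herm_conj_symm (γ x) (deriv (deriv γ) x), h.herm_second_deriv] at h1
  change ((speed γ x ^ 2 : ℝ) : ℂ) * _ = _ + ((speed γ x ^ 2 : ℝ) : ℂ) * _ at h1
  simp only [map_add, map_mul, map_neg, Complex.conj_ofReal, Complex.conj_I] at h1
  rw [arcDeriv]
  push_cast at h1 ⊢
  field_simp
  have h2 : ((speed γ x : ℝ) : ℂ) * (speed γ x * herm v (deriv (deriv γ) x)) =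
      ((speed γ x : ℝ) : ℂ) * (herm v (deriv γ x)
        * (deriv (speed γ) x - curvature γ x * speed γ x ^ 2 * Complex.I)
        - speed γ x ^ 3 * herm v (γ x)) := by
    linear_combination h1
  have h3 := mul_left_cancel₀ hne h2
  linear_combination h3

end Structure

/-! ### The variation field of a smooth family -/

section Variation

/-- The variation field `∂_t Γ` at `t = 0`. -/
def varField (Γ : ℝ → ℝ → C2) (x : ℝ) : C2 := deriv (Γ x) 0

/-- The component of the variation field along the unit tangent `T`. -/
def tangPart (Γ : ℝ → ℝ → C2) (x : ℝ) : ℝ :=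
  (herm (varField Γ x) (deriv (fun y => Γ y 0) x)).re / speed (fun y => Γ y 0) x

/-- The component of the variation field along `iT`. -/
def normPart (Γ : ℝ → ℝ → C2) (x : ℝ) : ℝ :=
  (herm (varField Γ x) (deriv (fun y => Γ y 0) x)).im / speed (fun y => Γ y 0) x

/-- The component of the variation field along `iγ`. -/
def reebPart (Γ : ℝ → ℝ → C2) (x : ℝ) : ℝ := (herm (varField Γ x) (Γ x 0)).im

variable {L ε : ℝ} {Γ : ℝ → ℝ → C2}

theorem zero_mem_Ioo_of_pos (hε : 0 < ε) : (0 : ℝ) ∈ Ioo (-ε) ε := by simp [hε]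

theorem periodic_deriv_t {E : Type*} [NormedAddCommGroup E] [NormedSpace ℝ E] {F : ℝ → ℝ → E}
    (hε : 0 < ε) (h : ∀ t ∈ Ioo (-ε) ε, Function.Periodic (fun x => F x t) L) :
    Function.Periodic (fun x => deriv (F x) 0) L := by
  intro x
  apply Filter.EventuallyEq.deriv_eq
  filter_upwards [isOpen_Ioo.mem_nhds (zero_mem_Ioo_of_pos hε)] with t ht
  exact h t ht x

theorem SmoothOnStrip.smoothPeriodic_deriv_t {F : ℝ → ℝ → ℝ} (hF : SmoothOnStrip ε F)
    (hε : 0 < ε) (h : ∀ t ∈ Ioo (-ε) ε, Function.Periodic (fun x => F x t) L) :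
    SmoothPeriodic L fun x => deriv (F x) 0 :=
  ⟨hF.deriv_t.contDiff_slice (zero_mem_Ioo_of_pos hε), periodic_deriv_t hε h⟩

namespace IsSmoothFamily

theorem loop_zero (h : IsSmoothFamily L ε Γ) (hε : 0 < ε) : IsLegendrianLoop L fun y => Γ y 0 :=
  h.loop 0 (zero_mem_Ioo_of_pos hε)

theorem contDiff_varField (h : IsSmoothFamily L ε Γ) (hε : 0 < ε) : ContDiff ℝ ∞ (varField Γ) :=
  h.smoothOnStrip.deriv_t.contDiff_slice (zero_mem_Ioo_of_pos hε)

theorem periodic_varField (h : IsSmoothFamily L ε Γ) (hε : 0 < ε) :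
    Function.Periodic (varField Γ) L :=
  periodic_deriv_t hε fun t ht => (h.loop t ht).periodic

theorem hasDerivAt_varField (h : IsSmoothFamily L ε Γ) (hε : 0 < ε) (x : ℝ) :
    HasDerivAt (varField Γ) (deriv (varField Γ) x) x :=
  ((h.contDiff_varField hε).differentiable (by simp) x).hasDerivAt

theorem hasDerivAt_deriv_varField (h : IsSmoothFamily L ε Γ) (hε : 0 < ε) (x : ℝ) :
    HasDerivAt (deriv (varField Γ)) (deriv (deriv (varField Γ)) x) x :=
  ((contDiff_infty_iff_deriv.1 (h.contDiff_varField hε)).2.differentiable (by simp) x).hasDerivAt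

theorem hasDerivAt_t (h : IsSmoothFamily L ε Γ) (hε : 0 < ε) (x : ℝ) :
    HasDerivAt (Γ x) (varField Γ x) 0 :=
  h.smoothOnStrip.hasDerivAt_t (zero_mem_Ioo_of_pos hε) x

theorem hasDerivAt_t_deriv (h : IsSmoothFamily L ε Γ) (hε : 0 < ε) (x : ℝ) :
    HasDerivAt (fun t => deriv (fun y => Γ y t) x) (deriv (varField Γ) x) 0 := by
  have h0 := zero_mem_Ioo_of_pos hε
  have h1 := h.smoothOnStrip.deriv_x.hasDerivAt_t h0 x
  rwa [h.smoothOnStrip.deriv_comm h0 x] at h1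

theorem hasDerivAt_t_deriv_deriv (h : IsSmoothFamily L ε Γ) (hε : 0 < ε) (x : ℝ) :
    HasDerivAt (fun t => deriv (deriv fun y => Γ y t) x) (deriv (deriv (varField Γ)) x) 0 := by
  have h0 := zero_mem_Ioo_of_pos hε
  have h1 := h.smoothOnStrip.deriv_x.deriv_x.hasDerivAt_t h0 x
  rw [h.smoothOnStrip.deriv_x.deriv_comm h0 x] at h1
  have h2 : (fun y => deriv (fun t => deriv (fun y' => Γ y' t) y) 0) = deriv (varField Γ) :=
    funext fun y => (h.hasDerivAt_t_deriv hε y).deriv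
  rwa [h2] at h1

theorem smoothPeriodic_herm {v w : ℝ → C2} (hv : ContDiff ℝ ∞ v) (hw : ContDiff ℝ ∞ w)
    (pv : Function.Periodic v L) (pw : Function.Periodic w L) :
    SmoothPeriodic L (fun x => (herm (v x) (w x)).re) ∧
      SmoothPeriodic L (fun x => (herm (v x) (w x)).im) := by
  have h1 : ContDiff ℝ ∞ fun x => herm (v x) (w x) := ContDiff.inner ℂ hw hv
  exact ⟨⟨Complex.reCLM.contDiff.comp h1, fun x => by simp only [pv x, pw x]⟩,
    ⟨Complex.imCLM.contDiff.comp h1, fun x => by simp only [pv x, pw x]⟩⟩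

theorem smoothPeriodic_tangPart (h : IsSmoothFamily L ε Γ) (hε : 0 < ε) :
    SmoothPeriodic L (tangPart Γ) :=
  (smoothPeriodic_herm (h.contDiff_varField hε) (h.loop_zero hε).contDiff_deriv
    (h.periodic_varField hε) (periodic_deriv (h.loop_zero hε).periodic)).1.mul
      (h.loop_zero hε).smoothPeriodic_inv_speed

theorem smoothPeriodic_normPart (h : IsSmoothFamily L ε Γ) (hε : 0 < ε) :
    SmoothPeriodic L (normPart Γ) :=
  (smoothPeriodic_herm (h.contDiff_varField hε) (h.loop_zero hε).contDiff_deriv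
    (h.periodic_varField hε) (periodic_deriv (h.loop_zero hε).periodic)).2.mul
      (h.loop_zero hε).smoothPeriodic_inv_speed

theorem smoothPeriodic_reebPart (h : IsSmoothFamily L ε Γ) (hε : 0 < ε) :
    SmoothPeriodic L (reebPart Γ) :=
  (smoothPeriodic_herm (h.contDiff_varField hε) (h.loop_zero hε).smooth
    (h.periodic_varField hε) (h.loop_zero hε).periodic).2

theorem herm_varField_deriv (h : IsSmoothFamily L ε Γ) (hε : 0 < ε) (x : ℝ) :
    herm (varField Γ x) (deriv (fun y => Γ y 0) x) =
      ((speed (fun y => Γ y 0) x * tangPart Γ x : ℝ) : ℂ)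
        + ((speed (fun y => Γ y 0) x * normPart Γ x : ℝ) : ℂ) * Complex.I := by
  have hne := ((h.loop_zero hε).speed_pos x).ne'
  rw [tangPart, normPart, mul_div_cancel₀ _ hne, mul_div_cancel₀ _ hne, Complex.re_add_im]

/-- The variation field is tangent to the sphere. -/
theorem herm_varField_self (h : IsSmoothFamily L ε Γ) (hε : 0 < ε) (x : ℝ) :
    herm (varField Γ x) (Γ x 0) = (reebPart Γ x : ℂ) * Complex.I := by
  have h1 := hasDerivAt_herm (h.hasDerivAt_t hε x) (h.hasDerivAt_t hε x)
  have h2 : (fun t => herm (Γ x t) (Γ x t)) =ᶠ[nhds 0] fun _ => 1 := by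
    filter_upwards [isOpen_Ioo.mem_nhds (zero_mem_Ioo_of_pos hε)] with t ht
    rw [herm_self, (h.loop t ht).sphere x]
    simp
  have h3 := (h1.congr_of_eventuallyEq h2.symm).unique (hasDerivAt_const 0 (1 : ℂ))
  rw [← herm_conj_symm (Γ x 0) (varField Γ x)] at h3
  have h4 := congrArg Complex.re h3
  simp only [Complex.add_re, Complex.conj_re, Complex.zero_re] at h4
  apply Complex.ext
  · simp only [Complex.re_ofReal_mul, Complex.I_re, mul_zero]
    linarith
  · simp [reebPart]

theorem herm_deriv_varField_self (h : IsSmoothFamily L ε Γ) (hε : 0 < ε) (x : ℝ) :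
    herm (deriv (varField Γ) x) (Γ x 0) = ((deriv (reebPart Γ) x : ℝ) : ℂ) * Complex.I
      - herm (varField Γ x) (deriv (fun y => Γ y 0) x) := by
  have h1 := hasDerivAt_herm (h.hasDerivAt_varField hε x) ((h.loop_zero hε).hasDerivAt x)
  simp only [h.herm_varField_self hε] at h1
  have h2 := h1.unique ((((h.smoothPeriodic_reebPart hε).differentiableAt
    x).hasDerivAt.ofReal_comp).mul_const Complex.I)
  linear_combination h2

/-- The linearized Legendrian condition. -/
theorem arcDeriv_reebPart (h : IsSmoothFamily L ε Γ) (hε : 0 < ε) (x : ℝ) :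
    arcDeriv (fun y => Γ y 0) (reebPart Γ) x = 2 * normPart Γ x := by
  have hpos := (h.loop_zero hε).speed_pos x
  have h1 := hasDerivAt_herm (h.hasDerivAt_t_deriv hε x) (h.hasDerivAt_t hε x)
  have h2 : (fun t => herm (deriv (fun y => Γ y t) x) (Γ x t)) =ᶠ[nhds 0] fun _ => 0 := by
    filter_upwards [isOpen_Ioo.mem_nhds (zero_mem_Ioo_of_pos hε)] with t ht
    exact (h.loop t ht).legendrian x
  have h3 := (h1.congr_of_eventuallyEq h2.symm).unique (hasDerivAt_const 0 (0 : ℂ))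
  rw [h.herm_deriv_varField_self hε,
    ← herm_conj_symm (deriv (fun y => Γ y 0) x) (varField Γ x), h.herm_varField_deriv hε] at h3
  have h4 := congrArg Complex.im h3
  simp only [map_add, map_mul, Complex.conj_ofReal, Complex.conj_I, Complex.add_im, Complex.sub_im,
    Complex.im_ofReal_mul, Complex.ofReal_im, Complex.I_im, Complex.neg_im, Complex.zero_im] at h4
  rw [arcDeriv]
  field_simp
  linarith

/-- `⟨V_x, γ_x⟩` in terms of the components of `V`. -/
theorem herm_deriv_varField_deriv (h : IsSmoothFamily L ε Γ) (hε : 0 < ε) (x : ℝ) :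
    (herm (deriv (varField Γ) x) (deriv (fun y => Γ y 0) x)).re =
      speed (fun y => Γ y 0) x ^ 2 * (arcDeriv (fun y => Γ y 0) (tangPart Γ) x
        - curvature (fun y => Γ y 0) x * normPart Γ x) ∧
    (herm (deriv (varField Γ) x) (deriv (fun y => Γ y 0) x)).im =
      speed (fun y => Γ y 0) x ^ 2 * (arcDeriv (fun y => Γ y 0) (normPart Γ) x
        + curvature (fun y => Γ y 0) x * tangPart Γ x + reebPart Γ x) := by
  have hγ := h.loop_zero hε
  have hpos := hγ.speed_pos x
  have h1 := hasDerivAt_herm (h.hasDerivAt_varField hε x) (hγ.hasDerivAt_deriv x)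
  simp only [h.herm_varField_deriv hε] at h1
  have ha := ((h.smoothPeriodic_tangPart hε).differentiableAt x).hasDerivAt
  have hb := ((h.smoothPeriodic_normPart hε).differentiableAt x).hasDerivAt
  have h2 := h1.unique ((((hγ.hasDerivAt_speed x).mul ha).ofReal_comp).add
    ((((hγ.hasDerivAt_speed x).mul hb).ofReal_comp).mul_const Complex.I))
  rw [hγ.herm_right_second_deriv, h.herm_varField_deriv hε, h.herm_varField_self hε] at h2
  have hre := congrArg Complex.re h2
  have him := congrArg Complex.im h2
  simp only [Complex.add_re, Complex.sub_re, Complex.mul_re, Complex.add_im, Complex.sub_im,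
    Complex.mul_im, Complex.ofReal_re, Complex.ofReal_im, Complex.I_re, Complex.I_im] at hre him
  simp only [hγ.deriv_eq_speed_mul] at hre him
  constructor
  · linear_combination hre
  · linear_combination him

/-- The variation of the arclength element. -/
theorem hasDerivAt_speed (h : IsSmoothFamily L ε Γ) (hε : 0 < ε) (x : ℝ) :
    HasDerivAt (fun t => speed (fun y => Γ y t) x) (speed (fun y => Γ y 0) x *
      (arcDeriv (fun y => Γ y 0) (tangPart Γ) x
        - curvature (fun y => Γ y 0) x * normPart Γ x)) 0 := by
  have hpos := (h.loop_zero hε).speed_pos x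
  have h1 := hasDerivAt_herm (h.hasDerivAt_t_deriv hε x) (h.hasDerivAt_t_deriv hε x)
  have h2 := h.smoothOnStrip_speed.hasDerivAt_t (zero_mem_Ioo_of_pos hε) x
  simp only [herm_deriv_self] at h1
  have h3 := h1.unique (h2.pow 2).ofReal_comp
  rw [← herm_conj_symm (deriv (fun y => Γ y 0) x) (deriv (varField Γ) x)] at h3
  have h4 := congrArg Complex.re h3
  simp only [Complex.add_re, Complex.conj_re, Complex.ofReal_re,
    (h.herm_deriv_varField_deriv hε x).1] at h4
  refine h2.congr_deriv ?_
  norm_num at h4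
  apply mul_left_cancel₀ hpos.ne'
  linarith

/-- The variation of the curvature. -/
theorem hasDerivAt_curvature (h : IsSmoothFamily L ε Γ) (hε : 0 < ε) (x : ℝ) :
    HasDerivAt (fun t => curvature (fun y => Γ y t) x)
      (tangPart Γ x * arcDeriv (fun y => Γ y 0) (curvature fun y => Γ y 0) x
        + arcDeriv (fun y => Γ y 0) (arcDeriv (fun y => Γ y 0) (normPart Γ)) x
        + curvature (fun y => Γ y 0) x ^ 2 * normPart Γ x + 4 * normPart Γ x) 0 := by
  have hγ := h.loop_zero hε
  have h0 := zero_mem_Ioo_of_pos hε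
  have hpos := hγ.speed_pos x
  have ha := h.smoothPeriodic_tangPart hε
  have hb := h.smoothPeriodic_normPart hε
  have hc := h.smoothPeriodic_reebPart hε
  have hb' := hγ.smoothPeriodic_arcDeriv hb
  have hκ := hγ.smoothPeriodic_curvature
  have hη : SmoothPeriodic L fun x => arcDeriv (fun y => Γ y 0) (normPart Γ) x
      + curvature (fun y => Γ y 0) x * tangPart Γ x + reebPart Γ x :=
    (hb'.add (hκ.mul ha)).add hc
  have hηs := arcDeriv_add (γ := fun y => Γ y 0) (hb'.add (hκ.mul ha)) hc x
  rw [arcDeriv_add hb' (hκ.mul ha), arcDeriv_mul hκ ha, h.arcDeriv_reebPart hε] at hηs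
  -- the derivative of `Im ⟨V_x, γ_x⟩` in `x`
  have h1 := Complex.imCLM.hasFDerivAt.comp_hasDerivAt x
    (hasDerivAt_herm (h.hasDerivAt_deriv_varField hε x) (hγ.hasDerivAt_deriv x))
  have e1 : (Complex.imCLM ∘ fun x =>
      herm (deriv (varField Γ) x) (deriv (fun y => Γ y 0) x)) = fun x =>
        speed (fun y => Γ y 0) x ^ 2 * (arcDeriv (fun y => Γ y 0) (normPart Γ) x
        + curvature (fun y => Γ y 0) x * tangPart Γ x + reebPart Γ x) :=
    funext fun x => (h.herm_deriv_varField_deriv hε x).2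
  rw [e1] at h1
  have h2 := h1.unique (((hγ.hasDerivAt_speed x).pow 2).mul (hη.differentiableAt x).hasDerivAt)
  simp only [hγ.deriv_eq_speed_mul, hηs, Pi.pow_apply] at h2
  -- the derivative of `Im ⟨γ_xx, γ_x⟩` in `t`
  have h3 := Complex.imCLM.hasFDerivAt.comp_hasDerivAt (0 : ℝ)
    (hasDerivAt_herm (h.hasDerivAt_t_deriv_deriv hε x) (h.hasDerivAt_t_deriv hε x))
  have hκt := h.smoothOnStrip_curvature.hasDerivAt_t h0 x
  have e2 : (Complex.imCLM ∘ fun t =>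
      herm (deriv (deriv fun y => Γ y t) x) (deriv (fun y => Γ y t) x)) =ᶠ[nhds 0] fun t =>
        curvature (fun y => Γ y t) x * speed (fun y => Γ y t) x ^ 3 := by
    filter_upwards [isOpen_Ioo.mem_nhds h0] with t ht
    have := ((h.loop t ht).speed_pos x).ne'
    simp only [curvature, Function.comp_apply, Complex.imCLM_apply]
    field_simp
  have h4 := (h3.congr_of_eventuallyEq e2.symm).unique (hκt.mul ((h.hasDerivAt_speed hε x).pow 3))
  rw [← herm_conj_symm (deriv (deriv fun y => Γ y 0) x) (deriv (varField Γ) x)] at h4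
  simp only [Complex.imCLM_apply, Complex.add_im, Complex.conj_im, hγ.herm_right_second_deriv,
    h.herm_deriv_varField_self hε, h.herm_varField_deriv hε] at h2 h4
  have hBr := (h.herm_deriv_varField_deriv hε x).1
  have hBi := (h.herm_deriv_varField_deriv hε x).2
  have hcx : deriv (reebPart Γ) x = speed (fun y => Γ y 0) x * (2 * normPart Γ x) := by
    rw [hγ.deriv_eq_speed_mul, h.arcDeriv_reebPart hε]
  simp only [Complex.sub_im, Complex.mul_im, Complex.sub_re, Complex.mul_re, Complex.ofReal_re,
    Complex.ofReal_im, Complex.I_re, Complex.I_im, Complex.add_im, hBr, hBi, hcx] at h2 h4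
  refine hκt.congr_deriv ?_
  apply mul_left_cancel₀ (pow_pos hpos 3).ne'
  norm_num at h2 h4
  -- The term `4b` arises as `2b + 2b`: one half from `c_s = 2b` in the derivative of `Im ⟨V_x,
  -- γ_x⟩`, the other from `Im ⟨V_x, γ⟩ = c_x - speed · b = speed · b` in `-2 Im ⟨V_x, γ_xx⟩`.
  linear_combination h2 - h4

end IsSmoothFamily
end Variation

end

section

open Set

/-! ### The first variation of curvature functionals -/

section FirstVariation

variable {L ε : ℝ} {Γ : ℝ → ℝ → C2}

/-- The variation of the curvature jet. -/
def jetVar (Γ : ℝ → ℝ → C2) (j : ℕ) (x : ℝ) : ℝ :=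
  deriv (fun t => curvJet (fun y => Γ y t) j x) 0

/-- The relative variation of the arclength element. -/
def stretch (Γ : ℝ → ℝ → C2) (x : ℝ) : ℝ :=
  arcDeriv (fun y => Γ y 0) (tangPart Γ) x - curvature (fun y => Γ y 0) x * normPart Γ x

namespace IsSmoothFamily

theorem smoothPeriodic_jetVar (h : IsSmoothFamily L ε Γ) (hε : 0 < ε) (j : ℕ) :
    SmoothPeriodic L (jetVar Γ j) :=
  (h.smoothOnStrip_curvJet j).smoothPeriodic_deriv_t hε
    fun t ht => ((h.loop t ht).smoothPeriodic_curvJet j).periodic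

theorem hasDerivAt_curvJet (h : IsSmoothFamily L ε Γ) (hε : 0 < ε) (j : ℕ) (x : ℝ) :
    HasDerivAt (fun t => curvJet (fun y => Γ y t) j x) (jetVar Γ j x) 0 :=
  (h.smoothOnStrip_curvJet j).hasDerivAt_t (zero_mem_Ioo_of_pos hε) x

/-- The variation does not commute with `∂_s = speed⁻¹ ∂_x`; differentiating `speed⁻¹` produces the
correction by the stretching factor. -/
theorem jetVar_succ (h : IsSmoothFamily L ε Γ) (hε : 0 < ε) (j : ℕ) (x : ℝ) :
    jetVar Γ (j + 1) x = arcDeriv (fun y => Γ y 0) (jetVar Γ j) x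
      - stretch Γ x * curvJet (fun y => Γ y 0) (j + 1) x := by
  have h0 := zero_mem_Ioo_of_pos hε
  have hpos := (h.loop_zero hε).speed_pos x
  have h1 := (h.smoothOnStrip_curvJet j).deriv_x.hasDerivAt_t h0 x
  rw [(h.smoothOnStrip_curvJet j).deriv_comm h0 x] at h1
  have h2 := ((h.hasDerivAt_speed hε x).inv hpos.ne').mul h1
  have h3 := h.hasDerivAt_curvJet hε (j + 1) x
  simp only [curvJet_succ] at h3
  have h4 := h3.unique h2
  rw [h4, curvJet_succ]
  simp only [arcDeriv, stretch, Pi.inv_apply]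
  have e : (fun y => deriv (fun τ => curvJet (fun y => Γ y τ) j y) 0) = jetVar Γ j := rfl
  rw [e]
  field_simp
  ring

theorem jetVar_zero (h : IsSmoothFamily L ε Γ) (hε : 0 < ε) (x : ℝ) :
    jetVar Γ 0 x = tangPart Γ x * arcDeriv (fun y => Γ y 0) (curvature fun y => Γ y 0) x
        + arcDeriv (fun y => Γ y 0) (arcDeriv (fun y => Γ y 0) (normPart Γ)) x
        + curvature (fun y => Γ y 0) x ^ 2 * normPart Γ x + 4 * normPart Γ x :=
  (h.hasDerivAt_curvature hε x).deriv

theorem hasDerivAt_curvFunctional (h : IsSmoothFamily L ε Γ) (hε : 0 < ε) (P : DiffPoly) :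
    HasDerivAt (fun t => curvFunctional L P fun x => Γ x t)
      (∫ x in (0 : ℝ)..L, (normPart Γ x * evalCurv (normalGrad P) (fun y => Γ y 0) x)
        * speed (fun y => Γ y 0) x) 0 := by
  have hF : SmoothOnStrip ε fun x t =>
      evalCurv P (fun y => Γ y t) x * speed (fun y => Γ y t) x :=
    ContDiffOn.mul (h.smoothOnStrip_evalCurv P) h.smoothOnStrip_speed
  refine (hF.hasDerivAt_integral L (zero_mem_Ioo_of_pos hε)).congr_deriv ?_
  rw [← (h.loop_zero hε).integral_variation (h.smoothPeriodic_jetVar hε)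
    (h.smoothPeriodic_tangPart hε) (h.smoothPeriodic_normPart hε) (h.jetVar_succ hε)
    (fun _ => rfl) (h.jetVar_zero hε)]
  refine intervalIntegral.integral_congr fun x _ => ?_
  have h1 := hasDerivAt_eval (k := fun t j => curvJet (fun y => Γ y t) j x)
    (fun j => h.hasDerivAt_curvJet hε j x) P
  have h2 := (h1.mul (h.hasDerivAt_speed hε x)).deriv
  refine Eq.trans h2 ?_
  simp only [evalCurv_eq, stretch]
  ring

end IsSmoothFamily

end FirstVariation

/-! ### Local vector fields -/

/-- The field `n T + (D ℓ) iT + 2 ℓ iγ`, evaluated at the curvature of `γ`. -/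
def localField (n ℓ : DiffPoly) (γ : ℝ → C2) (x : ℝ) : C2 :=
  evalCurv n γ x • ((speed γ x)⁻¹ • deriv γ x)
    + evalCurv (totalD ℓ) γ x • (Complex.I • ((speed γ x)⁻¹ • deriv γ x))
    + evalCurv (2 * ℓ) γ x • (Complex.I • γ x)

theorem evalCurv_two_mul (ℓ : DiffPoly) (γ : ℝ → C2) (x : ℝ) :
    evalCurv (2 * ℓ) γ x = 2 * evalCurv ℓ γ x := by
  rw [← C_two, evalCurv_mul, evalCurv_C]

section Field

variable {L : ℝ} {γ : ℝ → C2}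

theorem IsLegendrianLoop.herm_localField (h : IsLegendrianLoop L γ) (n ℓ : DiffPoly) (x : ℝ) :
    (herm (localField n ℓ γ x) (γ x)).im = 2 * evalCurv ℓ γ x ∧
    (herm (localField n ℓ γ x) (deriv γ x)).im = speed γ x * evalCurv (totalD ℓ) γ x := by
  have hpos := h.speed_pos x
  have h1 := h.legendrian x
  have h2 : herm (γ x) (γ x) = 1 := by rw [herm_self, h.sphere x]; simp
  have h3 := herm_deriv_self γ x
  have h4 : herm (γ x) (deriv γ x) = 0 := by
    rw [← herm_conj_symm, h1, map_zero]
  have e : ∀ w, herm (localField n ℓ γ x) w =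
      (evalCurv n γ x + evalCurv (totalD ℓ) γ x * Complex.I) * (speed γ x : ℂ)⁻¹
        * herm (deriv γ x) w + 2 * evalCurv ℓ γ x * Complex.I * herm (γ x) w := by
    intro w
    simp only [herm_eq, localField, evalCurv_two_mul, PiLp.add_apply, PiLp.smul_apply,
      Complex.real_smul, smul_eq_mul]
    push_cast
    ring
  constructor
  · rw [e, h1, h2]
    simp
  · rw [e, h3, h4]
    have : ((evalCurv n γ x + evalCurv (totalD ℓ) γ x * Complex.I) * (speed γ x : ℂ)⁻¹
        * ((speed γ x ^ 2 : ℝ) : ℂ) + 2 * evalCurv ℓ γ x * Complex.I * 0) =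
        ((speed γ x * evalCurv n γ x : ℝ) : ℂ)
          + ((speed γ x * evalCurv (totalD ℓ) γ x : ℝ) : ℂ) * Complex.I := by
      have hne : ((speed γ x : ℝ) : ℂ) ≠ 0 := by exact_mod_cast hpos.ne'
      push_cast
      field_simp
      ring
    rw [this]
    simp only [Complex.add_im, Complex.ofReal_im, Complex.im_ofReal_mul, Complex.I_im, mul_one,
      zero_add]

/-- The coefficient `2ℓ` of `iγ` has arclength derivative `2 D ℓ`, twice the coefficient of `iT`,
which is exactly the linearized Legendrian condition. -/
theorem IsLegendrianLoop.isTangent_localField (h : IsLegendrianLoop L γ) (n ℓ : DiffPoly) :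
    IsTangent L γ (localField n ℓ γ) := by
  have hn := (h.smoothPeriodic_evalCurv n).mul h.smoothPeriodic_inv_speed
  have hq := (h.smoothPeriodic_evalCurv (totalD ℓ)).mul h.smoothPeriodic_inv_speed
  have hr := h.smoothPeriodic_evalCurv (2 * ℓ)
  refine ⟨_, _, _, hn.smooth, hq.smooth, hr.smooth, hn.periodic, hq.periodic, hr.periodic,
    fun x => ?_, fun x => ?_⟩
  · have hpos := h.speed_pos x
    rw [h.deriv_eq_speed_mul, h.arcDeriv_evalCurv]
    have : totalD (2 * ℓ) = 2 * totalD ℓ := by rw [← C_two, totalD_C_mul]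
    rw [this, evalCurv_two_mul]
    field_simp
  · simp only [localField, mul_smul]
    rw [smul_comm Complex.I (speed γ x)⁻¹]

/-- The symplectic form against a local field. -/
theorem IsSmoothFamily.omega_localField {ε : ℝ} {Γ : ℝ → ℝ → C2} (h : IsSmoothFamily L ε Γ)
    (hε : 0 < ε) (n ℓ : DiffPoly) :
    Omega L (fun y => Γ y 0) (varField Γ) (localField n ℓ fun y => Γ y 0) =
      ∫ x in (0 : ℝ)..L, (normPart Γ x * (-4 * evalCurv ℓ (fun y => Γ y 0) x))
        * speed (fun y => Γ y 0) x := by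
  have hγ := h.loop_zero hε
  have hc := h.smoothPeriodic_reebPart hε
  have hℓ := hγ.smoothPeriodic_evalCurv ℓ
  rw [Omega, ← intervalIntegral.integral_neg]
  -- The determinant contributes `-2bℓ + c ℓ_s`; since `c_s = 2b`, the second term is `(cℓ)_s -
  -- 2bℓ`, which gives the factor `-4`.
  rw [← hγ.integral_congr_arcDeriv
    (f := fun x => -(2 * normPart Γ x * evalCurv ℓ (fun y => Γ y 0) x
      - reebPart Γ x * evalCurv (totalD ℓ) (fun y => Γ y 0) x))
    ((h.smoothPeriodic_normPart hε).mul (hℓ.const_mul (-4))) (hc.mul hℓ)]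
  · refine intervalIntegral.integral_congr fun x _ => ?_
    have hV : (herm (varField Γ x) (deriv (fun y => Γ y 0) x)).im =
        speed (fun y => Γ y 0) x * normPart Γ x := by
      rw [normPart, mul_div_cancel₀ _ (hγ.speed_pos x).ne']
    simp only [detR_eq (hγ.sphere x) (hγ.legendrian x), (hγ.herm_localField n ℓ x).1,
      (hγ.herm_localField n ℓ x).2, hV]
    rw [show (herm (varField Γ x) (Γ x 0)).im = reebPart Γ x from rfl]
    ring
  · intro x
    rw [arcDeriv_mul hc hℓ, hγ.arcDeriv_evalCurv, h.arcDeriv_reebPart hε]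
    ring

end Field

/-! ### Equivariance under rotations and reparametrizations -/

section Action

variable {L θ : ℝ} {φ : ℝ → ℝ} {γ : ℝ → C2}

theorem herm_act (θ : ℝ) (φ : ℝ → ℝ) (V W : ℝ → C2) (x : ℝ) :
    herm (act θ φ V x) (act θ φ W x) = herm (V (φ x)) (W (φ x)) := by
  have h1 : Complex.exp (θ * Complex.I) * (starRingEnd ℂ) (Complex.exp (θ * Complex.I)) = 1 := by
    rw [Complex.mul_conj, Complex.normSq_eq_norm_sq, Complex.norm_exp_ofReal_mul_I]
    simp
  simp only [herm_eq, act, PiLp.smul_apply, smul_eq_mul, map_mul]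
  linear_combination (V (φ x) 0 * (starRingEnd ℂ) (W (φ x) 0)
    + V (φ x) 1 * (starRingEnd ℂ) (W (φ x) 1)) * h1

theorem norm_act (θ : ℝ) (φ : ℝ → ℝ) (V : ℝ → C2) (x : ℝ) : ‖act θ φ V x‖ = ‖V (φ x)‖ := by
  rw [act, norm_smul, Complex.norm_exp_ofReal_mul_I, one_mul]

theorem IsReparam.hasDerivAt (hφ : IsReparam L φ) (x : ℝ) : HasDerivAt φ (deriv φ x) x :=
  (hφ.smooth.differentiable (by simp) x).hasDerivAt

theorem hasDerivAt_act (hφ : IsReparam L φ) {V : ℝ → C2} (hV : ContDiff ℝ ∞ V) (x : ℝ) :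
    HasDerivAt (act θ φ V) (deriv φ x • act θ φ (deriv V) x) x := by
  have h1 := ((hV.differentiable (by simp) (φ x)).hasDerivAt.scomp x
    (hφ.hasDerivAt x)).const_smul (Complex.exp (θ * Complex.I))
  rw [smul_comm] at h1
  exact h1

theorem deriv_act (hφ : IsReparam L φ) (h : IsLegendrianLoop L γ) :
    deriv (act θ φ γ) = fun x => deriv φ x • act θ φ (deriv γ) x :=
  funext fun x => (hasDerivAt_act hφ h.smooth x).deriv

theorem speed_act (hφ : IsReparam L φ) (h : IsLegendrianLoop L γ) (x : ℝ) :
    speed (act θ φ γ) x = deriv φ x * speed γ (φ x) := by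
  rw [speed, deriv_act hφ h, norm_smul, norm_act, Real.norm_of_nonneg (hφ.deriv_pos x).le, speed]

theorem herm_real_smul (r s : ℝ) (v w : C2) :
    herm (r • v) (s • w) = ((r * s : ℝ) : ℂ) * herm v w := by
  simp only [herm_eq, PiLp.smul_apply, Complex.real_smul, map_mul, Complex.conj_ofReal]
  push_cast
  ring

theorem herm_add_left (u v w : C2) : herm (u + v) w = herm u w + herm v w :=
  inner_add_right w u v

/-- The extra term `φ'' γ_x` in the second derivative pairs with `γ_x` to a real number, so it does
not affect the imaginary part; the powers of `φ'` cancel. -/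
theorem curvature_act (hφ : IsReparam L φ) (h : IsLegendrianLoop L γ) (x : ℝ) :
    curvature (act θ φ γ) x = curvature γ (φ x) := by
  have hpos := hφ.deriv_pos x
  have hs := h.speed_pos (φ x)
  have hφ' : HasDerivAt (deriv φ) (deriv (deriv φ) x) x :=
    ((contDiff_infty_iff_deriv.1 hφ.smooth).2.differentiable (by simp) x).hasDerivAt
  have h1 := (hφ'.smul (hasDerivAt_act (θ := θ) hφ h.contDiff_deriv x)).deriv
  have h2 : deriv (deriv (act θ φ γ)) x =
      (deriv φ x * deriv φ x) • act θ φ (deriv (deriv γ)) x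
        + deriv (deriv φ) x • act θ φ (deriv γ) x := by
    rw [deriv_act hφ h, mul_smul]
    exact h1
  rw [curvature, h2, speed_act hφ h, deriv_act hφ h, herm_add_left, herm_real_smul, herm_real_smul,
    herm_act, herm_act, herm_deriv_self, Complex.add_im, Complex.im_ofReal_mul,
    Complex.im_ofReal_mul, Complex.ofReal_im, curvature]
  field_simp
  ring

theorem arcDeriv_act (hφ : IsReparam L φ) (h : IsLegendrianLoop L γ) {f : ℝ → ℝ}
    (hf : SmoothPeriodic L f) (x : ℝ) :
    arcDeriv (act θ φ γ) (fun x => f (φ x)) x = arcDeriv γ f (φ x) := by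
  have hpos := hφ.deriv_pos x
  have hs := h.speed_pos (φ x)
  have h1 : deriv (fun x => f (φ x)) x = deriv f (φ x) * deriv φ x :=
    ((hf.differentiableAt (φ x)).hasDerivAt.comp x (hφ.hasDerivAt x)).deriv
  rw [arcDeriv, arcDeriv, speed_act hφ h, h1]
  field_simp

theorem curvJet_act (hφ : IsReparam L φ) (h : IsLegendrianLoop L γ) (j : ℕ) :
    curvJet (act θ φ γ) j = fun x => curvJet γ j (φ x) := by
  induction j with
  | zero => exact funext fun x => curvature_act hφ h x
  | succ j ih =>
    ext x
    rw [curvJet_succ, ih, arcDeriv_act hφ h (h.smoothPeriodic_curvJet j), curvJet_succ]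

theorem evalCurv_act (hφ : IsReparam L φ) (h : IsLegendrianLoop L γ) (P : DiffPoly) (x : ℝ) :
    evalCurv P (act θ φ γ) x = evalCurv P γ (φ x) := by
  simp only [evalCurv_eq, curvJet_act hφ h]

theorem localField_act (hφ : IsReparam L φ) (h : IsLegendrianLoop L γ) (n ℓ : DiffPoly) (x : ℝ) :
    localField n ℓ (act θ φ γ) x = act θ φ (localField n ℓ γ) x := by
  have hpos := hφ.deriv_pos x
  have h1 : (speed (act θ φ γ) x)⁻¹ • deriv (act θ φ γ) x =
      Complex.exp (θ * Complex.I) • ((speed γ (φ x))⁻¹ • deriv γ (φ x)) := by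
    rw [speed_act hφ h, deriv_act hφ h, smul_smul, mul_inv, mul_assoc,
      mul_comm _ (deriv φ x), ← mul_assoc, inv_mul_cancel₀ hpos.ne', one_mul, act, smul_comm]
  rw [localField, h1]
  simp only [evalCurv_act hφ h]
  simp only [act, localField, smul_add]
  simp only [smul_comm (Complex.exp (θ * Complex.I))]

/-- Change of variables turns the domain into `[φ 0, φ 0 + L]`, and a periodic function has the same
integral over every period. -/
theorem curvFunctional_act (hφ : IsReparam L φ) (h : IsLegendrianLoop L γ) (P : DiffPoly) :
    curvFunctional L P (act θ φ γ) = curvFunctional L P γ := by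
  have hper := (h.smoothPeriodic_evalCurv P).mul h.smoothPeriodic_speed
  have h1 : ∀ x, evalCurv P (act θ φ γ) x * speed (act θ φ γ) x =
      ((fun y => evalCurv P γ y * speed γ y) ∘ φ) x * deriv φ x := fun x => by
    rw [evalCurv_act hφ h, speed_act hφ h, Function.comp_apply]
    ring
  simp only [curvFunctional, h1]
  rw [intervalIntegral.integral_comp_mul_deriv (fun x _ => hφ.hasDerivAt x)
    (contDiff_infty_iff_deriv.1 hφ.smooth).2.continuous.continuousOn hper.smooth.continuous]
  have h2 := hφ.shift 0
  rw [zero_add] at h2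
  rw [h2, hper.periodic.intervalIntegral_add_eq (φ 0) 0, zero_add]

end Action

/-! ### Hamiltonian fields -/

/-- The field `n T + (D ℓ) iT + 2 ℓ iγ` is the Hamiltonian vector field of `∫ P ds` when `-4 ℓ`
is the normal gradient of `P`. -/
theorem isHamiltonianFieldOf_localField (L : ℝ) {P ℓ : DiffPoly}
    (hP : normalGrad P = MvPolynomial.C (-4) * ℓ) (n : DiffPoly) :
    IsHamiltonianFieldOf L (curvFunctional L P) (localField n ℓ) where
  functional :=
    { invariant := fun γ hγ θ φ hφ => curvFunctional_act hφ hγ P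
      smooth := fun ε Γ _ hΓ => by
        have hF : SmoothOnStrip ε fun x t =>
            evalCurv P (fun y => Γ y t) x * speed (fun y => Γ y t) x :=
          ContDiffOn.mul (hΓ.smoothOnStrip_evalCurv P) hΓ.smoothOnStrip_speed
        exact hF.contDiffOn_integral L }
  field :=
    { tangent := fun γ hγ => hγ.isTangent_localField n ℓ
      -- Local fields are exactly equivariant, so the vertical difference is zero.
      descends := fun γ hγ θ φ hφ => ⟨0, fun _ => 0, contDiff_const, fun _ => rfl, fun x => by
        simp [localField_act hφ hγ]⟩ }
  hamilton := fun γ ε Γ hε hΓ h0 => by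
    obtain rfl : γ = fun y => Γ y 0 := funext fun x => (h0 x).symm
    refine (hΓ.hasDerivAt_curvFunctional hε P).congr_deriv ?_
    have h1 := hΓ.omega_localField hε n ℓ
    refine Eq.trans ?_ h1.symm
    simp only [hP, evalCurv_mul, evalCurv_C]

/-! ### The gradients of the hierarchy -/

theorem energy_add (P Q : DiffPoly) : energy (P + Q) = energy P + energy Q :=
  eq_of_totalD_eq (by simp only [map_add, totalD_energy, euler_add, mul_add])
    (by simp only [map_add, constantCoeff_energy])

theorem energy_C_mul (a : ℝ) (P : DiffPoly) :
    energy (MvPolynomial.C a * P) = MvPolynomial.C a * energy P :=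
  eq_of_totalD_eq (by rw [totalD_C_mul, totalD_energy, totalD_energy, euler_C_mul]; ring)
    (by simp only [map_mul, constantCoeff_energy])

theorem normalGrad_add (P Q : DiffPoly) : normalGrad (P + Q) = normalGrad P + normalGrad Q := by
  simp only [normalGrad, euler_add, energy_add, map_add]
  ring

theorem normalGrad_C_mul (a : ℝ) (P : DiffPoly) :
    normalGrad (MvPolynomial.C a * P) = MvPolynomial.C a * normalGrad P := by
  simp only [normalGrad, euler_C_mul, energy_C_mul, totalD_C_mul]
  ring

/-- For a constant density the Noether integral is the constant itself: this is the first variation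
of length. It supplies the multiple of `E ρ_1 = u` missing from the telescoping sum. -/
theorem normalGrad_C (a : ℝ) :
    normalGrad (MvPolynomial.C a) = -MvPolynomial.C a * MvPolynomial.X 0 := by
  simp only [normalGrad, euler_C, energy, MvPolynomial.vars_C, Finset.sum_empty, map_zero]
  ring

section Hierarchy

variable {ρ N : ℕ → DiffPoly}

theorem IsMKdVHierarchy.euler_succ (h : IsMKdVHierarchy ρ N) {j : ℕ} (hj : 1 ≤ j) :
    euler (ρ (j + 1)) = totalD (totalD (euler (ρ j))) + MvPolynomial.X 0 * N j :=
  eq_of_totalD_eq (by rw [h.recursion j hj, map_add])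
    (by rw [h.constantCoeff_euler (j + 1) (by omega)]; simp [constantCoeff_totalD])

/-- Both sides have total derivative `u₁ E ρ_j`, because `D N_j = u D E ρ_j`; the normalization of
the constant terms does the rest. -/
theorem IsMKdVHierarchy.energy_eq (h : IsMKdVHierarchy ρ N) {j : ℕ} (hj : 1 ≤ j) :
    energy (ρ j) = MvPolynomial.X 0 * euler (ρ j) - N j := by
  apply eq_of_totalD_eq
  · rw [totalD_energy, map_sub, Derivation.leibniz, h.totalD_N j hj, totalD_X]
    simp only [smul_eq_mul]
    ring
  · rw [constantCoeff_energy, h.constantCoeff_rho j hj]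
    simp [h.constantCoeff_N j hj]

/-- Substituting `G = u E ρ_j - N_j` cancels `u² E ρ_j` and leaves `D² E ρ_j + u N_j`, the
right-hand side of the integrated recursion, plus the curvature term `4 E ρ_j`. -/
theorem IsMKdVHierarchy.normalGrad_rho (h : IsMKdVHierarchy ρ N) {j : ℕ} (hj : 1 ≤ j) :
    normalGrad (ρ j) = euler (ρ (j + 1)) + MvPolynomial.C 4 * euler (ρ j) := by
  rw [normalGrad, h.euler_succ hj, h.energy_eq hj]
  ring

theorem IsMKdVHierarchy.euler_rho_one (h : IsMKdVHierarchy ρ N) :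
    euler (ρ 1) = MvPolynomial.X 0 := by
  -- Writing `u²/2` as `N_1` reduces its Euler derivative to `euler_flux`.
  have h1 : ρ 1 = MvPolynomial.C ((2 * (1 : ℕ) - 1 : ℝ)⁻¹) * flux 1 := by
    rw [h.rho_one, flux_one]
    norm_num
  rw [h1, euler_C_mul, euler_flux, grad_one]
  norm_num

/-- The telescoping sum of the gradients. -/
theorem IsMKdVHierarchy.normalGrad_sum (h : IsMKdVHierarchy ρ N) (j : ℕ) :
    normalGrad (∑ k ∈ Finset.Icc 1 j, MvPolynomial.C ((-4 : ℝ) ^ (j - k)) * ρ k) =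
      euler (ρ (j + 1)) - MvPolynomial.C ((-4 : ℝ) ^ j) * euler (ρ 1) := by
  induction j with
  | zero =>
    have := normalGrad_C 0
    simpa using this
  | succ j ih =>
    have h1 : ∑ k ∈ Finset.Icc 1 (j + 1), MvPolynomial.C ((-4 : ℝ) ^ (j + 1 - k)) * ρ k =
        MvPolynomial.C (-4) * ∑ k ∈ Finset.Icc 1 j, MvPolynomial.C ((-4 : ℝ) ^ (j - k)) * ρ k
          + ρ (j + 1) := by
      rw [Finset.sum_Icc_succ_top (by omega), Finset.mul_sum]
      congr 1
      · refine Finset.sum_congr rfl fun k hk => ?_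
        have : j + 1 - k = (j - k) + 1 := by
          have := (Finset.mem_Icc.1 hk).2
          omega
        rw [this, pow_succ, MvPolynomial.C_mul]
        ring
      · simp
    rw [h1, normalGrad_add, normalGrad_C_mul, ih, h.normalGrad_rho (by omega), pow_succ,
      MvPolynomial.C_mul, MvPolynomial.C_neg]
    ring

end Hierarchy

theorem curvFunctional_C_mul (L a : ℝ) (P : DiffPoly) (γ : ℝ → C2) :
    curvFunctional L (MvPolynomial.C a * P) γ = a * curvFunctional L P γ := by
  simp only [curvFunctional, evalCurv_mul, evalCurv_C, mul_assoc,
    intervalIntegral.integral_const_mul]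

theorem localField_sub_smul (n ℓ n' ℓ' : DiffPoly) (c : ℝ) (γ : ℝ → C2) (x : ℝ) :
    localField n ℓ γ x - c • localField n' ℓ' γ x =
      localField (n - MvPolynomial.C c * n') (ℓ - MvPolynomial.C c * ℓ') γ x := by
  simp only [localField, map_sub, totalD_C_mul, evalCurv_sub, evalCurv_mul, evalCurv_C]
  module

end

end LegendrianMKdV

end

/-! ### Hamiltonian structure of the mKdV fields -/

open LegendrianMKdV in
theorem mainTheorem2 (L : ℝ) (hL : 0 < L) :
    (∃ ρ N : ℕ → DiffPoly, IsMKdVHierarchy ρ N) ∧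
    ∀ ρ N : ℕ → DiffPoly, IsMKdVHierarchy ρ N →
      (∀ j, 1 ≤ j → ∃ H : (ℝ → C2) → ℝ, IsHamiltonianFieldOf L H (mkdvField ρ N j)) ∧
      (∀ j, 1 ≤ j → IsHamiltonianFieldOf L
        (fun γ => -4 * curvFunctional L
          (∑ k ∈ Finset.Icc 1 j, MvPolynomial.C ((-4 : ℝ) ^ (j - k)) * ρ k) γ)
        (fun γ x => mkdvField ρ N (j + 1) γ x - (-4 : ℝ) ^ j • mkdvField ρ N 1 γ x)) := by
  refine ⟨exists_isMKdVHierarchy, fun ρ N h => ⟨fun j hj => ?_, fun j _ => ?_⟩⟩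
  · obtain ⟨m, rfl⟩ : ∃ m, j = m + 1 := ⟨j - 1, by omega⟩
    -- The constant density `-(-4)^m` has normal gradient `(-4)^m u`, which cancels the term
    -- `-(-4)^m E ρ_1` left by the telescoping sum. For `m = 0` the functional is 4 times the
    -- length.
    refine ⟨_, isHamiltonianFieldOf_localField L (P := MvPolynomial.C (-4) *
      (∑ k ∈ Finset.Icc 1 m, MvPolynomial.C ((-4 : ℝ) ^ (m - k)) * ρ k
        + MvPolynomial.C (-(-4 : ℝ) ^ m))) (ℓ := euler (ρ (m + 1))) ?_ (N (m + 1))⟩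
    rw [normalGrad_C_mul, normalGrad_add, h.normalGrad_sum, normalGrad_C, h.euler_rho_one]
    simp only [map_neg]
    ring
  · have hP := isHamiltonianFieldOf_localField L (P := MvPolynomial.C (-4) *
      ∑ k ∈ Finset.Icc 1 j, MvPolynomial.C ((-4 : ℝ) ^ (j - k)) * ρ k)
      (ℓ := euler (ρ (j + 1)) - MvPolynomial.C ((-4 : ℝ) ^ j) * euler (ρ 1))
      (by rw [normalGrad_C_mul, h.normalGrad_sum])
      (N (j + 1) - MvPolynomial.C ((-4 : ℝ) ^ j) * N 1)
    have hH : (fun γ => -4 * curvFunctional L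
        (∑ k ∈ Finset.Icc 1 j, MvPolynomial.C ((-4 : ℝ) ^ (j - k)) * ρ k) γ) =
        curvFunctional L (MvPolynomial.C (-4) *
          ∑ k ∈ Finset.Icc 1 j, MvPolynomial.C ((-4 : ℝ) ^ (j - k)) * ρ k) :=
      funext fun γ => (curvFunctional_C_mul L _ _ γ).symm
    have hW : (fun γ x => mkdvField ρ N (j + 1) γ x - (-4 : ℝ) ^ j • mkdvField ρ N 1 γ x) =
        localField (N (j + 1) - MvPolynomial.C ((-4 : ℝ) ^ j) * N 1)
          (euler (ρ (j + 1)) - MvPolynomial.C ((-4 : ℝ) ^ j) * euler (ρ 1)) :=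
      funext fun γ => funext fun x => localField_sub_smul _ _ _ _ _ γ x
    rw [hH, hW]
    exact hP
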